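/- Let $\Bbbk$ be a field of characteristic zero, let $t,a,b,p\in\Bbbk$ with $t\neq 0$, and let $V$ be the vector space with basis $x_1,x_2,x_3$ and braiding $c=c_{t,a,b,p}$ of type $\mathfrak{R}_{1,1}$: \begin{align*} c(x_1\otimes x_1)&=t\,x_1\otimes x_1,\quad c(x_2\otimes x_1)=t\,x_1\otimes x_2,\quad c(x_3\otimes x_1)=t\,x_1\otimes x_3+ta\,x_1\otimes x_1,\\ c(x_1\otimes x_2)&=t\,x_2\otimes x_1,\quad c(x_2\otimes x_2)=t\,x_2\otimes x_2,\\ c(x_3\otimes x_2)&=t\,x_2\otimes x_3+ta\,x_2\otimes x_1+t(a-b)\,x_1\otimes x_2,\\ c(x_1\otimes x_3)&=t\,x_3\otimes x_1-ta\,x_1\otimes x_1,\\ c(x_2\otimes x_3)&=t\,x_3\otimes x_2+t(b-a)\,x_2\otimes x_1-ta\,x_1\otimes x_2,\\ c(x_3\otimes x_3)&=t\,x_3\otimes x_3+tb\,x_3\otimes x_1-tp\,x_2\otimes x_1-tb\,x_1\otimes x_3+tp\,x_1\otimes x_2-tab\,x_1\otimes x_1. \end{align*} Let $\mathfrak{B}(V)=T(V)/\mathcal{J}(V)$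 be its Nichols algebra, where $\mathcal{J}(V)$ is the largest homogeneous Hopf ideal of the braided Hopf algebra $T(V)$ (the elements of $V$ being primitive) generated by homogeneous elements of degree at least $2$. 1. If $t^2\neq 1$, there are no quadratic relations: $\mathcal{J}(V)\cap T^2(V)=0$. 2. If $t=-1$, then $$\mathcal{J}(V)=\langle x_2x_1+x_1x_2,\ x_3x_1+x_1x_3,\ x_3x_2+x_2x_3-b\,x_1x_2,\ x_1^2,\ x_2^2,\ x_3^2-b\,x_1x_3+p\,x_1x_2\rangle,$$ the monomials $x_1^{a_1}x_2^{a_2}x_3^{a_3}$ with $a_i\in\{0,1\}$ form a basis of $\mathfrak{B}(V)$, $\dim\mathfrak{B}(V)=8$ and $\operatorname{GKdim}\mathfrak{B}(V)=0$. 3. If $t=1$, then $$\mathcal{J}(V)=\langle x_2x_1-x_1x_2,\ x_3x_1-x_1x_3-a\,x_1^2,\ x_3x_2-x_2x_3+(b-2a)\,x_1x_2\rangle,$$ the monomials $x_1^{a_1}x_2^{a_2}x_3^{a_3}$ with $a_i\geq 0$ form a (PBW) basis of $\mathfrak{B}(V)$, and $\operatorname{GKdim}\mathfrak{B}(V)=3$.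 -/

import Mathlib

open scoped TensorProduct

noncomputable section

namespace BraidedNichols

section General

variable {k : Type*} [Field k] {ι : Type*} [Fintype ι] [DecidableEq ι]

/-!
Let `V` be the vector space with basis `x_i`, `i : ι`. Its tensor algebra `T(V)` is the free
algebra `FreeAlgebra k ι`. A linear endomorphism `c` of `V ⊗ V` is encoded by its structure
constants `r`: `c (x_i ⊗ x_j) = ∑ m l, r i j m l • x_m ⊗ x_l`.
-/

/-- The homogeneous component `T^n(V)`, spanned by the words of length `n`. -/
def tensorPower (k : Type*) [Field k] (ι : Type*) (n : ℕ) : Submodule k (FreeAlgebra k ι) :=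
  Submodule.span k (Set.range (FreeAlgebra.ι k)) ^ n

/-- The extension of `c` to a map `V ⊗ T(V) → T(V) ⊗ V`, in matrix form:
`c (x_i ⊗ y) = ∑ l, letterBraiding r y i l ⊗ x_l`. The compatibility
`c (id ⊗ mul) = (mul ⊗ id) (id ⊗ c) (c ⊗ id)` of the braiding of `T(V)` with the product says
exactly that this matrix is multiplicative in `y`. -/
def letterBraiding (r : ι → ι → ι → ι → k) :
    FreeAlgebra k ι →ₐ[k] Matrix ι ι (FreeAlgebra k ι) :=
  FreeAlgebra.lift k fun j =>
    Matrix.of fun i l => ∑ m, r i j m l • FreeAlgebra.ι k m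

/-- Left multiplication by `1 ⊗ x_i` in the braided tensor product algebra `T(V) ⊗ T(V)`, whose
product is `(a ⊗ b) (a' ⊗ b') = a c(b ⊗ a') b'`. So
`y ⊗ z ↦ c (x_i ⊗ y) (1 ⊗ z) = ∑ l, letterBraiding r y i l ⊗ x_l z`. -/
def mulRightLetter (r : ι → ι → ι → ι → k) (i : ι) :
    Module.End k (FreeAlgebra k ι ⊗[k] FreeAlgebra k ι) :=
  ∑ l, TensorProduct.map
    (Matrix.entryLinearMap k (FreeAlgebra k ι) i l ∘ₗ (letterBraiding r).toLinearMap)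
    (LinearMap.mulLeft k (FreeAlgebra.ι k l))

/-- Left multiplication by `x_i ⊗ 1` in the braided tensor product algebra `T(V) ⊗ T(V)`. -/
def mulLeftLetter (i : ι) : Module.End k (FreeAlgebra k ι ⊗[k] FreeAlgebra k ι) :=
  TensorProduct.map (LinearMap.mulLeft k (FreeAlgebra.ι k i)) LinearMap.id

/-- The comultiplication of the braided Hopf algebra `T(V)`: the algebra map from `T(V)` to the
braided tensor product algebra `T(V) ⊗ T(V)` with `x_i ↦ x_i ⊗ 1 + 1 ⊗ x_i`. It is obtained by
letting `x_i` act by left multiplication by `x_i ⊗ 1 + 1 ⊗ x_i`, and applying the operator of an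
element of `T(V)` to the unit `1 ⊗ 1`. -/
def comul (r : ι → ι → ι → ι → k) :
    FreeAlgebra k ι →ₗ[k] FreeAlgebra k ι ⊗[k] FreeAlgebra k ι :=
  LinearMap.applyₗ (1 ⊗ₜ[k] 1) ∘ₗ
    (FreeAlgebra.lift k fun i => mulLeftLetter i + mulRightLetter r i).toLinearMap

/-- A two-sided ideal `I` of `T(V)` is a homogeneous Hopf ideal generated in degrees at least two
if it is generated by homogeneous elements of degree at least two and
`Δ(I) ⊆ I ⊗ T(V) + T(V) ⊗ I`. (The counit vanishes on such an ideal, since its elements have no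
component of degree `0`. Stability under the antipode is automatic, since `T(V)/I` is a connected
graded braided bialgebra.) -/
structure IsHopfIdeal (r : ι → ι → ι → ι → k) (I : TwoSidedIdeal (FreeAlgebra k ι)) : Prop where
  generated : I = TwoSidedIdeal.span {x | x ∈ I ∧ ∃ n, 2 ≤ n ∧ x ∈ tensorPower k ι n}
  coideal : ∀ x ∈ I, comul r x ∈ Submodule.span k
    {z : FreeAlgebra k ι ⊗[k] FreeAlgebra k ι | ∃ u v, (u ∈ I ∨ v ∈ I) ∧ z = u ⊗ₜ[k] v}

/-- The defining ideal `J(V)` of the Nichols algebra: the largest homogeneous Hopf ideal of `T(V)`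
generated in degrees at least two, that is, the sum of all of them. -/
def nicholsIdeal (r : ι → ι → ι → ι → k) : TwoSidedIdeal (FreeAlgebra k ι) :=
  sSup {I | IsHopfIdeal r I}

/-- The Nichols algebra `B(V) = T(V) / J(V)`. -/
abbrev NicholsAlgebra (r : ι → ι → ι → ι → k) : Type _ := (nicholsIdeal r).ringCon.Quotient

/-- The image of the basis vector `x_i` in the Nichols algebra. -/
def NicholsAlgebra.gen (r : ι → ι → ι → ι → k) (i : ι) : NicholsAlgebra r :=
  (nicholsIdeal r).ringCon.mk' (FreeAlgebra.ι k i)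

end General

/-- The Gelfand-Kirillov dimension of a `k`-algebra `A`: the supremum, over the finite-dimensional
subspaces `W` of `A` containing `1`, of `limsup (log (dim W ^ n) / log n)`. -/
def gkDim (k : Type*) [Field k] (A : Type*) [Ring A] [Algebra k A] : EReal :=
  ⨆ W : {W : Submodule k A // FiniteDimensional k W ∧ (1 : A) ∈ W},
    Filter.limsup
      (fun n : ℕ => ((Real.log (Module.finrank k ↥(W.1 ^ n)) / Real.log n : ℝ) : EReal))
      Filter.atTop

/-- The braiding `c` of type `R_{1,1}` on the space with basis `x_1, x_2, x_3` (indexed by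
`0, 1, 2`). The matrix in row `i`, column `j` has as its entry `(m, l)` the coefficient of
`x_m ⊗ x_l` in `c (x_i ⊗ x_j)`. -/
def braidingR11 {k : Type*} [Field k] (t a b p : k) : Fin 3 → Fin 3 → Fin 3 → Fin 3 → k :=
  ![![!![t, 0, 0;
         0, 0, 0;
         0, 0, 0],
      !![0, 0, 0;
         t, 0, 0;
         0, 0, 0],
      !![-(t * a), 0, 0;
         0, 0, 0;
         t, 0, 0]],
    ![!![0, t, 0;
         0, 0, 0;
         0, 0, 0],
      !![0, 0, 0;
         0, t, 0;
         0, 0, 0],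
      !![0, -(t * a), 0;
         t * (b - a), 0, 0;
         0, t, 0]],
    ![!![t * a, 0, t;
         0, 0, 0;
         0, 0, 0],
      !![0, t * (a - b), 0;
         t * a, 0, t;
         0, 0, 0],
      !![-(t * a * b), t * p, -(t * b);
         -(t * p), 0, 0;
         t * b, 0, t]]]

section Relations

variable {k : Type*} [Field k]

/-- The generators `x_1, x_2, x_3` of `T(V)`, indexed by `0, 1, 2`. -/
abbrev X (i : Fin 3) : FreeAlgebra k (Fin 3) := FreeAlgebra.ι k i

/-- The quadratic relations for `t = -1`. -/
def relationsMinusOne (b p : k) : Set (FreeAlgebra k (Fin 3)) :=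
  {X 1 * X 0 + X 0 * X 1,
   X 2 * X 0 + X 0 * X 2,
   X 2 * X 1 + X 1 * X 2 - b • (X 0 * X 1),
   X 0 ^ 2,
   X 1 ^ 2,
   X 2 ^ 2 - b • (X 0 * X 2) + p • (X 0 * X 1)}

/-- The quadratic relations for `t = 1`. -/
def relationsOne (a b : k) : Set (FreeAlgebra k (Fin 3)) :=
  {X 1 * X 0 - X 0 * X 1,
   X 2 * X 0 - X 0 * X 2 - a • X 0 ^ 2,
   X 2 * X 1 - X 1 * X 2 + (b - 2 * a) • (X 0 * X 1)}

/-- The image of the ordered monomial `x_1^{e_1} x_2^{e_2} x_3^{e_3}` in the Nichols algebra. -/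
def orderedMonomial (r : Fin 3 → Fin 3 → Fin 3 → Fin 3 → k) (e : Fin 3 → ℕ) :
    NicholsAlgebra r :=
  NicholsAlgebra.gen r 0 ^ e 0 * NicholsAlgebra.gen r 1 ^ e 1 * NicholsAlgebra.gen r 2 ^ e 2

end Relations

end BraidedNichols

end

/-!
The skew derivations `∂_l` of `T(V)` preserve `J(V)`, and `J(V)` has no component of degree `0`.
Hence an element of `J(V)` is killed by every composite of skew derivations followed by the counit.

In degree two this says that `1 + c` kills the quadratic part of `J(V)`. Since the eigenvalues of
`c` are `± t`, that part is zero if `t ^ 2 ≠ 1`.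

The functional `ε ∂_1^{e_1} ∂_2^{e_2} ∂_3^{e_3}` kills every ordered monomial which is
lexicographically smaller than `x_1^{e_1} x_2^{e_2} x_3^{e_3}` (comparing the exponents of `x_3`
first) and takes the product of the `t`-factorials of the `e_i` on this monomial. So ordered
monomials whose exponents have nonzero `t`-factorials are linearly independent in `B(V)`. For
`t = ± 1`, the listed relations are primitive and span a subspace stable under the braiding, hence
generate a Hopf ideal, which is contained in `J(V)`. They rewrite every word in terms of ordered
monomials, so that the quotient by this ideal is spanned by monomials which remain linearly
independent in `B(V)`. Hence the ideal is `J(V)`.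
-/

namespace BraidedNichols

open FreeAlgebra (ι algebraMapInv)

section FreeAlgebra

variable {k : Type*} [Field k] {σ : Type*}

theorem freeAlgebra_induction_left {P : FreeAlgebra k σ → Prop} (one : P 1)
    (add : ∀ x y, P x → P y → P (x + y)) (smul : ∀ (s : k) x, P x → P (s • x))
    (mul : ∀ i x, P x → P (ι k i * x)) (y : FreeAlgebra k σ) : P y := by
  have mul_left (z : FreeAlgebra k σ) : ∀ y, P y → P (z * y) := by
    induction z with
    | grade0 s => intro y hy; rw [← Algebra.smul_def]; exact smul _ _ hy
    | grade1 i => intro y hy; exact mul _ _ hy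
    | mul u v hu hv => intro y hy; rw [mul_assoc]; exact hu _ (hv _ hy)
    | add u v hu hv => intro y hy; rw [add_mul]; exact add _ _ (hu _ hy) (hv _ hy)
  simpa using mul_left y 1 one

theorem tensorPower_zero_le {p : Submodule k (FreeAlgebra k σ)} (h : 1 ∈ p) :
    tensorPower k σ 0 ≤ p := by
  rwa [tensorPower, pow_zero, Submodule.one_le]

theorem one_mem_tensorPower_zero : 1 ∈ tensorPower k σ 0 := by
  rw [tensorPower, pow_zero]
  exact Submodule.one_le.mp le_rfl

theorem tensorPower_succ_le {n : ℕ} {p : Submodule k (FreeAlgebra k σ)}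
    (h : ∀ i, ∀ x ∈ tensorPower k σ n, ι k i * x ∈ p) : tensorPower k σ (n + 1) ≤ p := by
  rw [tensorPower, pow_succ', Submodule.mul_le]
  intro u hu v hv
  have span_le_comap :
      Submodule.span k (Set.range (ι k)) ≤ p.comap (LinearMap.mulRight k v) := by
    rw [Submodule.span_le]
    rintro _ ⟨i, rfl⟩
    exact h i v hv
  exact span_le_comap hu

theorem ι_pow_mem_tensorPower (i : σ) (n : ℕ) : ι k i ^ n ∈ tensorPower k σ n :=
  Submodule.pow_mem_pow _ (Submodule.subset_span (Set.mem_range_self i)) n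

theorem ι_mem_tensorPower_one (i : σ) : ι k i ∈ tensorPower k σ 1 := by
  simpa using ι_pow_mem_tensorPower (k := k) i 1

theorem mul_mem_tensorPower {m n : ℕ} {x y : FreeAlgebra k σ} (hx : x ∈ tensorPower k σ m)
    (hy : y ∈ tensorPower k σ n) : x * y ∈ tensorPower k σ (m + n) := by
  rw [tensorPower, pow_add]
  exact Submodule.mul_mem_mul hx hy

theorem ι_mul_mem_tensorPower {n : ℕ} (i : σ) {x : FreeAlgebra k σ} (hx : x ∈ tensorPower k σ n) :
    ι k i * x ∈ tensorPower k σ (n + 1) :=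
  add_comm 1 n ▸ mul_mem_tensorPower (ι_mem_tensorPower_one i) hx

theorem algebraMapInv_ι_mul (i : σ) (y : FreeAlgebra k σ) :
    algebraMapInv (ι k i * y) = (0 : k) := by
  simp [algebraMapInv]

theorem algebraMapInv_eq_zero_of_mem_tensorPower {n : ℕ} {x : FreeAlgebra k σ}
    (hx : x ∈ tensorPower k σ (n + 1)) : algebraMapInv x = (0 : k) :=
  tensorPower_succ_le (p := LinearMap.ker algebraMapInv.toLinearMap)
    (fun i y _ => algebraMapInv_ι_mul i y) hx

theorem smul_mem_twoSidedIdeal {A : Type*} [Ring A] [Algebra k A] (I : TwoSidedIdeal A) (s : k)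
    {x : A} (hx : x ∈ I) : s • x ∈ I := by
  rw [Algebra.smul_def]
  exact I.mul_mem_left _ _ hx

variable [DecidableEq σ]

/-- The truncation `T(V) → k ⊕ V` which kills all words of length at least two, with `V` written
in coordinates. -/
def truncation : FreeAlgebra k σ →ₐ[k] TrivSqZeroExt k (σ → k) :=
  FreeAlgebra.lift k fun i => TrivSqZeroExt.inr (Pi.single i 1)

/-- The coefficient of the letter `x_l` in an element of the free algebra. -/
def letterCoeff (l : σ) : FreeAlgebra k σ →ₗ[k] k :=
  LinearMap.proj l ∘ₗ TrivSqZeroExt.sndHom k (σ → k) ∘ₗ truncation.toLinearMap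

theorem truncation_ι (i : σ) :
    truncation (ι k i) = TrivSqZeroExt.inr (Pi.single i 1) := by
  simp [truncation]

theorem fst_truncation (y : FreeAlgebra k σ) : (truncation y).fst = algebraMapInv y := by
  have : (TrivSqZeroExt.fstHom k k (σ → k)).comp truncation =
      (algebraMapInv : FreeAlgebra k σ →ₐ[k] k) := by
    ext i
    simp [truncation_ι, algebraMapInv]
  exact DFunLike.congr_fun this y

theorem letterCoeff_one (l : σ) : letterCoeff l (1 : FreeAlgebra k σ) = 0 := by
  simp [letterCoeff]

theorem letterCoeff_ι_mul (l i : σ) (y : FreeAlgebra k σ) :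
    letterCoeff l (ι k i * y) = if i = l then algebraMapInv y else 0 := by
  simp [letterCoeff, truncation_ι, fst_truncation, Pi.single_apply, eq_comm]

theorem truncation_eq_zero_of_mem_tensorPower {n : ℕ} (hn : 2 ≤ n) {x : FreeAlgebra k σ}
    (hx : x ∈ tensorPower k σ n) : truncation x = 0 := by
  obtain ⟨n, rfl⟩ := Nat.exists_eq_add_of_le' hn
  refine tensorPower_succ_le (p := LinearMap.ker truncation.toLinearMap) (fun i y hy => ?_) hx
  have fst_eq_zero : (truncation y).fst = 0 := by
    rw [fst_truncation, algebraMapInv_eq_zero_of_mem_tensorPower hy]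
  simp only [LinearMap.mem_ker, AlgHom.toLinearMap_apply, map_mul, truncation_ι]
  ext <;> simp [fst_eq_zero]

end FreeAlgebra

section SkewDerivations

variable {k : Type*} [Field k] {σ : Type*}

/-- Contraction of the second tensor factor with a functional `φ`: the map `y ⊗ z ↦ φ(z) y`. -/
def contractRight (φ : FreeAlgebra k σ →ₗ[k] k) :
    FreeAlgebra k σ ⊗[k] FreeAlgebra k σ →ₗ[k] FreeAlgebra k σ :=
  (TensorProduct.rid k _).toLinearMap ∘ₗ LinearMap.lTensor _ φ

theorem contractRight_tmul (φ : FreeAlgebra k σ →ₗ[k] k) (y z : FreeAlgebra k σ) :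
    contractRight φ (y ⊗ₜ[k] z) = φ z • y := by
  simp [contractRight]

theorem mulLeftLetter_tmul (i : σ) (y z : FreeAlgebra k σ) :
    mulLeftLetter i (y ⊗ₜ[k] z) = (ι k i * y) ⊗ₜ[k] z := by
  simp [mulLeftLetter]

theorem contractRight_mulLeftLetter (φ : FreeAlgebra k σ →ₗ[k] k) (i : σ)
    (z : FreeAlgebra k σ ⊗[k] FreeAlgebra k σ) :
    contractRight φ (mulLeftLetter i z) = ι k i * contractRight φ z := by
  induction z with
  | zero => simp
  | tmul u v => simp [mulLeftLetter_tmul, contractRight_tmul]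
  | add u v hu hv => simp only [map_add, mul_add, hu, hv]

variable [DecidableEq σ] [Fintype σ] (r : σ → σ → σ → σ → k)

theorem letterBraiding_ι (i j l : σ) :
    letterBraiding r (ι k j) i l = ∑ m, r i j m l • ι k m := by
  simp [letterBraiding]

theorem mulRightLetter_tmul (i : σ) (y z : FreeAlgebra k σ) :
    mulRightLetter r i (y ⊗ₜ[k] z) = ∑ l, letterBraiding r y i l ⊗ₜ[k] (ι k l * z) := by
  simp [mulRightLetter]

theorem comul_one : comul r 1 = 1 ⊗ₜ[k] 1 := by simp [comul]

theorem comul_ι_mul (i : σ) (y : FreeAlgebra k σ) :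
    comul r (ι k i * y) = mulLeftLetter i (comul r y) + mulRightLetter r i (comul r y) := by
  simp [comul]

theorem contractRight_algebraMapInv_mulRightLetter (i : σ)
    (z : FreeAlgebra k σ ⊗[k] FreeAlgebra k σ) :
    contractRight algebraMapInv.toLinearMap (mulRightLetter r i z) = 0 := by
  induction z with
  | zero => simp
  | tmul u v => simp [mulRightLetter_tmul, contractRight_tmul, algebraMapInv]
  | add u v hu hv => simp only [map_add, hu, hv, add_zero]

theorem contractRight_letterCoeff_mulRightLetter (l i : σ)
    (z : FreeAlgebra k σ ⊗[k] FreeAlgebra k σ) :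
    contractRight (letterCoeff l) (mulRightLetter r i z) =
      letterBraiding r (contractRight algebraMapInv.toLinearMap z) i l := by
  induction z with
  | zero => simp
  | tmul u v => simp [mulRightLetter_tmul, contractRight_tmul, letterCoeff_ι_mul]
  | add u v hu hv => simp only [map_add, hu, hv, Matrix.add_apply]

theorem contractRight_algebraMapInv_comul (y : FreeAlgebra k σ) :
    contractRight algebraMapInv.toLinearMap (comul r y) = y := by
  induction y using freeAlgebra_induction_left with
  | one => simp [comul_one, contractRight_tmul]
  | add x y hx hy => rw [map_add, map_add, hx, hy]
  | smul s x hx => rw [map_smul, map_smul, hx]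
  | mul i x hx =>
    rw [comul_ι_mul, map_add, contractRight_mulLeftLetter,
      contractRight_algebraMapInv_mulRightLetter, hx, add_zero]

/-- The skew derivation `∂_l` of `T(V)`, given by `Δ(y) = y ⊗ 1 + ∑ l, ∂_l y ⊗ x_l + ⋯`. -/
def skewDeriv (l : σ) : Module.End k (FreeAlgebra k σ) :=
  contractRight (letterCoeff l) ∘ₗ comul r

theorem skewDeriv_one (l : σ) : skewDeriv r l 1 = 0 := by
  simp [skewDeriv, comul_one, contractRight_tmul, letterCoeff_one]

theorem skewDeriv_ι_mul (l i : σ) (y : FreeAlgebra k σ) :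
    skewDeriv r l (ι k i * y) = ι k i * skewDeriv r l y + letterBraiding r y i l := by
  simp [skewDeriv, comul_ι_mul, contractRight_mulLeftLetter,
    contractRight_letterCoeff_mulRightLetter, contractRight_algebraMapInv_comul]

theorem skewDeriv_ι (l i : σ) : skewDeriv r l (ι k i) = if i = l then 1 else 0 := by
  simpa [skewDeriv_one, Matrix.one_apply] using skewDeriv_ι_mul r l i 1

theorem letterBraiding_mem_tensorPower {n : ℕ} {y : FreeAlgebra k σ}
    (hy : y ∈ tensorPower k σ n) (i l : σ) : letterBraiding r y i l ∈ tensorPower k σ n := by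
  suffices tensorPower k σ n ≤ (tensorPower k σ n).comap
      (Matrix.entryLinearMap k _ i l ∘ₗ (letterBraiding r).toLinearMap) from this hy
  induction n generalizing y i l with
  | zero =>
    refine tensorPower_zero_le ?_
    simp only [Submodule.mem_comap, LinearMap.comp_apply, AlgHom.toLinearMap_apply, map_one,
      Matrix.entryLinearMap_apply, Matrix.one_apply]
    split_ifs
    · exact one_mem_tensorPower_zero
    · exact zero_mem _
  | succ n ih =>
    refine tensorPower_succ_le fun j x hx => ?_
    simp only [Submodule.mem_comap, LinearMap.comp_apply, AlgHom.toLinearMap_apply, map_mul,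
      Matrix.entryLinearMap_apply, Matrix.mul_apply, letterBraiding_ι, Finset.sum_mul,
      smul_mul_assoc]
    exact Submodule.sum_mem _ fun m _ => Submodule.sum_mem _ fun m' _ => Submodule.smul_mem _ _
      (ι_mul_mem_tensorPower m' (ih hx m l hx))

theorem skewDeriv_eq_zero_of_mem_tensorPower_zero (l : σ) {y : FreeAlgebra k σ}
    (hy : y ∈ tensorPower k σ 0) : skewDeriv r l y = 0 :=
  tensorPower_zero_le (p := LinearMap.ker (skewDeriv r l)) (skewDeriv_one r l) hy

theorem skewDeriv_mem_tensorPower (l : σ) {n : ℕ} {y : FreeAlgebra k σ}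
    (hy : y ∈ tensorPower k σ (n + 1)) : skewDeriv r l y ∈ tensorPower k σ n := by
  induction n generalizing y with
  | zero =>
    refine tensorPower_succ_le (p := (tensorPower k σ 0).comap (skewDeriv r l))
      (fun i x hx => ?_) hy
    rw [Submodule.mem_comap, skewDeriv_ι_mul, skewDeriv_eq_zero_of_mem_tensorPower_zero r l hx,
      mul_zero, zero_add]
    exact letterBraiding_mem_tensorPower r hx _ _
  | succ n ih =>
    refine tensorPower_succ_le (p := (tensorPower k σ (n + 1)).comap (skewDeriv r l))
      (fun i x hx => ?_) hy
    rw [Submodule.mem_comap, skewDeriv_ι_mul]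
    exact add_mem (ι_mul_mem_tensorPower i (ih hx)) (letterBraiding_mem_tensorPower r hx _ _)

theorem skewDeriv_pow_eq_zero (l : σ) {m n : ℕ} (hmn : m < n) {y : FreeAlgebra k σ}
    (hy : y ∈ tensorPower k σ m) : (skewDeriv r l ^ n) y = 0 := by
  induction m generalizing n y with
  | zero =>
    obtain ⟨n, rfl⟩ := Nat.exists_eq_succ_of_ne_zero hmn.ne'
    rw [pow_succ, Module.End.mul_apply, skewDeriv_eq_zero_of_mem_tensorPower_zero r l hy, map_zero]
  | succ m ih =>
    obtain ⟨n, rfl⟩ := Nat.exists_eq_succ_of_ne_zero (Nat.ne_zero_of_lt hmn)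
    rw [pow_succ, Module.End.mul_apply]
    exact ih (by omega) (skewDeriv_mem_tensorPower r l hy)

end SkewDerivations

section HopfIdeals

variable {k : Type*} [Field k] {σ : Type*}

/-- The subspace `I ⊗ T(V) + T(V) ⊗ I` of `T(V) ⊗ T(V)`. -/
def tensorIdeal (I : TwoSidedIdeal (FreeAlgebra k σ)) :
    Submodule k (FreeAlgebra k σ ⊗[k] FreeAlgebra k σ) :=
  Submodule.span k {z | ∃ u v, (u ∈ I ∨ v ∈ I) ∧ z = u ⊗ₜ[k] v}

theorem tensorIdeal_mono {I J : TwoSidedIdeal (FreeAlgebra k σ)} (h : I ≤ J) :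
    tensorIdeal I ≤ tensorIdeal J :=
  Submodule.span_mono fun _ ⟨u, v, huv, hz⟩ => ⟨u, v, huv.imp (@h u) (@h v), hz⟩

variable [DecidableEq σ] [Fintype σ] {r : σ → σ → σ → σ → k}
  {I : TwoSidedIdeal (FreeAlgebra k σ)}

theorem IsHopfIdeal.truncation_eq_zero (hI : IsHopfIdeal r I) {x : FreeAlgebra k σ}
    (hx : x ∈ I) : truncation x = 0 := by
  have : I ≤ TwoSidedIdeal.ker (truncation (k := k) (σ := σ)) := by
    rw [hI.generated, TwoSidedIdeal.span_le]
    rintro y ⟨-, n, hn, hy⟩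
    exact (TwoSidedIdeal.mem_ker _).mpr (truncation_eq_zero_of_mem_tensorPower hn hy)
  exact (TwoSidedIdeal.mem_ker _).mp (this hx)

theorem IsHopfIdeal.algebraMapInv_eq_zero (hI : IsHopfIdeal r I) {x : FreeAlgebra k σ}
    (hx : x ∈ I) : algebraMapInv x = (0 : k) := by
  rw [← fst_truncation, hI.truncation_eq_zero hx, TrivSqZeroExt.fst_zero]

theorem IsHopfIdeal.letterCoeff_eq_zero (hI : IsHopfIdeal r I) (l : σ) {x : FreeAlgebra k σ}
    (hx : x ∈ I) : letterCoeff l x = 0 := by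
  simp [letterCoeff, hI.truncation_eq_zero hx]

theorem IsHopfIdeal.skewDeriv_mem (hI : IsHopfIdeal r I) (l : σ) {x : FreeAlgebra k σ}
    (hx : x ∈ I) : skewDeriv r l x ∈ I := by
  have contract_mem : ∀ z ∈ tensorIdeal I, contractRight (letterCoeff l) z ∈ I := by
    intro z hz
    induction hz using Submodule.span_induction with
    | mem z h =>
      obtain ⟨u, v, hu | hv, rfl⟩ := h <;> rw [contractRight_tmul]
      · exact smul_mem_twoSidedIdeal I _ hu
      · rw [hI.letterCoeff_eq_zero l hv, zero_smul]; exact I.zero_mem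
    | zero => rw [map_zero]; exact I.zero_mem
    | add x y _ _ hx hy => rw [map_add]; exact I.add_mem hx hy
    | smul s x _ hx => rw [map_smul]; exact smul_mem_twoSidedIdeal I _ hx
  exact contract_mem _ (hI.coideal x hx)

theorem IsHopfIdeal.skewDeriv_pow_mem (hI : IsHopfIdeal r I) (l : σ) (n : ℕ)
    {x : FreeAlgebra k σ} (hx : x ∈ I) : (skewDeriv r l ^ n) x ∈ I := by
  induction n with
  | zero => exact hx
  | succ n ih => rw [pow_succ', Module.End.mul_apply]; exact hI.skewDeriv_mem l ih

theorem IsHopfIdeal.le_nicholsIdeal (hI : IsHopfIdeal r I) : I ≤ nicholsIdeal r :=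
  le_sSup hI

theorem mem_addSubgroup_closure_of_mem_nicholsIdeal {x : FreeAlgebra k σ}
    (hx : x ∈ nicholsIdeal r) :
    x ∈ AddSubgroup.closure {y | ∃ I, IsHopfIdeal r I ∧ y ∈ I} := by
  have hle : nicholsIdeal r ≤ TwoSidedIdeal.span {y | ∃ I, IsHopfIdeal r I ∧ y ∈ I} :=
    sSup_le fun I hI y hy => TwoSidedIdeal.subset_span ⟨I, hI, hy⟩
  refine (TwoSidedIdeal.mem_span_iff_mem_addSubgroup_closure_absorbing ?_ ?_).mp (hle hx)
  · rintro a y ⟨I, hI, hy⟩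
    exact ⟨I, hI, I.mul_mem_left _ _ hy⟩
  · rintro y a ⟨I, hI, hy⟩
    exact ⟨I, hI, I.mul_mem_right _ _ hy⟩

theorem isHopfIdeal_nicholsIdeal (r : σ → σ → σ → σ → k) : IsHopfIdeal r (nicholsIdeal r) where
  generated := by
    refine le_antisymm (sSup_le fun I hI => ?_) (TwoSidedIdeal.span_le.mpr fun x hx => hx.1)
    rw [hI.generated]
    exact TwoSidedIdeal.span_mono fun x hx => ⟨hI.le_nicholsIdeal hx.1, hx.2⟩
  coideal x hx := by
    replace hx := mem_addSubgroup_closure_of_mem_nicholsIdeal hx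
    induction hx using AddSubgroup.closure_induction with
    | mem x h =>
      obtain ⟨I, hI, hx⟩ := h
      exact tensorIdeal_mono hI.le_nicholsIdeal (hI.coideal x hx)
    | zero => rw [map_zero]; exact zero_mem _
    | add x y _ _ hx hy => rw [map_add]; exact add_mem hx hy
    | neg x _ hx => rw [map_neg]; exact neg_mem hx

end HopfIdeals

section BraidedProduct

variable {k : Type*} [Field k] {σ : Type*}

/-- The operators of left multiplication by `y ⊗ 1` in the braided tensor product algebra. -/
def leftAction : FreeAlgebra k σ →ₐ[k] Module.End k (FreeAlgebra k σ ⊗[k] FreeAlgebra k σ) :=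
  FreeAlgebra.lift k mulLeftLetter

theorem leftAction_ι (i : σ) : leftAction (ι k i) = mulLeftLetter i := by
  simp [leftAction]

theorem leftAction_tmul (y u v : FreeAlgebra k σ) : leftAction y (u ⊗ₜ[k] v) = (y * u) ⊗ₜ[k] v := by
  induction y using freeAlgebra_induction_left with
  | one => simp
  | add x y hx hy => simp [hx, hy, add_mul, TensorProduct.add_tmul]
  | smul s x hx => simp [hx, TensorProduct.smul_tmul']
  | mul i x hx =>
    rw [map_mul, Module.End.mul_apply, hx, leftAction_ι, mulLeftLetter_tmul, mul_assoc]

variable [DecidableEq σ] [Fintype σ] (r : σ → σ → σ → σ → k)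

/-- The operators of left multiplication by `1 ⊗ y` in the braided tensor product algebra. -/
def rightAction : FreeAlgebra k σ →ₐ[k] Module.End k (FreeAlgebra k σ ⊗[k] FreeAlgebra k σ) :=
  FreeAlgebra.lift k (mulRightLetter r)

/-- The product of the braided tensor product algebra `T(V) ⊗ T(V)`: the element `u ⊗ v` acts as
`(u ⊗ 1) (1 ⊗ v)`. -/
def braidedMul : FreeAlgebra k σ ⊗[k] FreeAlgebra k σ →ₗ[k]
    Module.End k (FreeAlgebra k σ ⊗[k] FreeAlgebra k σ) :=
  LinearMap.mul' k _ ∘ₗ TensorProduct.map leftAction.toLinearMap (rightAction r).toLinearMap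

theorem rightAction_ι (i : σ) : rightAction r (ι k i) = mulRightLetter r i := by
  simp [rightAction]

theorem rightAction_one_tmul (y v : FreeAlgebra k σ) :
    rightAction r y (1 ⊗ₜ[k] v) = 1 ⊗ₜ[k] (y * v) := by
  induction y using freeAlgebra_induction_left with
  | one => simp
  | add x y hx hy => simp [hx, hy, add_mul, TensorProduct.tmul_add]
  | smul s x hx => simp [hx]
  | mul i x hx =>
    simp [hx, rightAction_ι, mulRightLetter_tmul, Matrix.one_apply, TensorProduct.ite_tmul,
      mul_assoc]

theorem mulRightLetter_mul_leftAction (i : σ) (y : FreeAlgebra k σ) :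
    mulRightLetter r i * leftAction y =
      ∑ l, leftAction (letterBraiding r y i l) * mulRightLetter r l := by
  refine TensorProduct.ext' fun u v => ?_
  simp only [Module.End.mul_apply, LinearMap.sum_apply, leftAction_tmul, mulRightLetter_tmul,
    map_mul, map_sum, Matrix.mul_apply, TensorProduct.sum_tmul]
  exact Finset.sum_comm

theorem braidedMul_tmul (u v : FreeAlgebra k σ) :
    braidedMul r (u ⊗ₜ[k] v) = leftAction u * rightAction r v := by
  simp [braidedMul]

theorem braidedMul_mulLeftLetter (i : σ) (z : FreeAlgebra k σ ⊗[k] FreeAlgebra k σ) :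
    braidedMul r (mulLeftLetter i z) = mulLeftLetter i * braidedMul r z := by
  induction z with
  | zero => simp
  | tmul u v => simp [mulLeftLetter_tmul, braidedMul_tmul, leftAction_ι, mul_assoc]
  | add u v hu hv => simp only [map_add, hu, hv, mul_add]

theorem braidedMul_mulRightLetter (i : σ) (z : FreeAlgebra k σ ⊗[k] FreeAlgebra k σ) :
    braidedMul r (mulRightLetter r i z) = mulRightLetter r i * braidedMul r z := by
  induction z with
  | zero => simp
  | tmul u v =>
    simp only [mulRightLetter_tmul, map_sum, braidedMul_tmul, map_mul, rightAction_ι,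
      ← mul_assoc, mulRightLetter_mul_leftAction, Finset.sum_mul]
  | add u v hu hv => simp only [map_add, hu, hv, mul_add]

theorem comul_mul (y z : FreeAlgebra k σ) :
    comul r (y * z) = braidedMul r (comul r y) (comul r z) := by
  induction y using freeAlgebra_induction_left with
  | one => simp [comul_one, braidedMul_tmul]
  | add x y hx hy => simp only [add_mul, map_add, hx, hy, LinearMap.add_apply]
  | smul s x hx => simp only [smul_mul_assoc, map_smul, hx, LinearMap.smul_apply]
  | mul i x hx =>
    simp only [mul_assoc, comul_ι_mul, hx, map_add, braidedMul_mulLeftLetter,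
      braidedMul_mulRightLetter, LinearMap.add_apply, Module.End.mul_apply]

/-- The extension of `c` to a map `T(V) ⊗ V → V ⊗ T(V)`, in matrix form:
`c (y ⊗ x_j) = ∑ m, x_m ⊗ wordBraiding r y m j`. -/
def wordBraiding : FreeAlgebra k σ →ₐ[k] Matrix σ σ (FreeAlgebra k σ) :=
  FreeAlgebra.lift k fun i => Matrix.of fun m j => ∑ l, r i j m l • ι k l

theorem wordBraiding_ι (i m j : σ) :
    wordBraiding r (ι k i) m j = ∑ l, r i j m l • ι k l := by
  simp [wordBraiding]

theorem mulRightLetter_mul_mulLeftLetter (i j : σ) :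
    mulRightLetter r i * mulLeftLetter j =
      ∑ m, mulLeftLetter m * rightAction r (wordBraiding r (ι k i) m j) := by
  simp only [← leftAction_ι, mulRightLetter_mul_leftAction, letterBraiding_ι, wordBraiding_ι,
    map_sum, map_smul, rightAction_ι, Finset.sum_mul, Finset.mul_sum, smul_mul_assoc,
    mul_smul_comm]
  exact Finset.sum_comm

theorem rightAction_mul_mulLeftLetter (y : FreeAlgebra k σ) (j : σ) :
    rightAction r y * mulLeftLetter j =
      ∑ m, mulLeftLetter m * rightAction r (wordBraiding r y m j) := by
  induction y using freeAlgebra_induction_left generalizing j with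
  | one => simp [Matrix.one_apply, apply_ite (rightAction r)]
  | add x y hx hy =>
    simp only [map_add, add_mul, hx, hy, Matrix.add_apply, mul_add, Finset.sum_add_distrib]
  | smul s x hx =>
    simp only [map_smul, smul_mul_assoc, hx, Matrix.smul_apply, mul_smul_comm, Finset.smul_sum]
  | mul i x hx =>
    simp only [map_mul, mul_assoc, hx, rightAction_ι, Finset.mul_sum, Matrix.mul_apply, map_sum]
    simp only [← mul_assoc, mulRightLetter_mul_mulLeftLetter, Finset.sum_mul]
    exact Finset.sum_comm

end BraidedProduct

section BraidedIdeals

variable {k : Type*} [Field k] {σ : Type*}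

theorem tmul_mem_tensorIdeal_left {I : TwoSidedIdeal (FreeAlgebra k σ)} {u : FreeAlgebra k σ}
    (hu : u ∈ I) (v : FreeAlgebra k σ) : u ⊗ₜ[k] v ∈ tensorIdeal I :=
  Submodule.subset_span ⟨u, v, .inl hu, rfl⟩

theorem tmul_mem_tensorIdeal_right {I : TwoSidedIdeal (FreeAlgebra k σ)} (u : FreeAlgebra k σ)
    {v : FreeAlgebra k σ} (hv : v ∈ I) : u ⊗ₜ[k] v ∈ tensorIdeal I :=
  Submodule.subset_span ⟨u, v, .inr hv, rfl⟩

theorem tensorIdeal_le_comap {I : TwoSidedIdeal (FreeAlgebra k σ)}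
    {f : Module.End k (FreeAlgebra k σ ⊗[k] FreeAlgebra k σ)}
    (left : ∀ u ∈ I, ∀ v, f (u ⊗ₜ[k] v) ∈ tensorIdeal I)
    (right : ∀ u, ∀ v ∈ I, f (u ⊗ₜ[k] v) ∈ tensorIdeal I) :
    tensorIdeal I ≤ (tensorIdeal I).comap f := by
  refine Submodule.span_le.mpr ?_
  rintro _ ⟨u, v, hu | hv, rfl⟩
  · exact left u hu v
  · exact right u v hv

theorem leftAction_mem_tensorIdeal {I : TwoSidedIdeal (FreeAlgebra k σ)} (y : FreeAlgebra k σ)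
    {z : FreeAlgebra k σ ⊗[k] FreeAlgebra k σ} (hz : z ∈ tensorIdeal I) :
    leftAction y z ∈ tensorIdeal I := by
  refine tensorIdeal_le_comap (fun u hu v => ?_) (fun u v hv => ?_) hz <;> rw [leftAction_tmul]
  · exact tmul_mem_tensorIdeal_left (I.mul_mem_left _ _ hu) v
  · exact tmul_mem_tensorIdeal_right _ hv

theorem leftAction_mem_tensorIdeal_of_mem {I : TwoSidedIdeal (FreeAlgebra k σ)}
    {y : FreeAlgebra k σ} (hy : y ∈ I) (z : FreeAlgebra k σ ⊗[k] FreeAlgebra k σ) :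
    leftAction y z ∈ tensorIdeal I := by
  induction z with
  | zero => simp
  | tmul u v =>
    rw [leftAction_tmul]
    exact tmul_mem_tensorIdeal_left (I.mul_mem_right _ _ hy) v
  | add u v hu hv => rw [map_add]; exact add_mem hu hv

variable [DecidableEq σ] [Fintype σ]

/-- An ideal `I` of `T(V)` which is stable under the braiding of `T(V)` with `V`, on both sides:
`c (V ⊗ I) ⊆ I ⊗ V` and `c (I ⊗ V) ⊆ V ⊗ I`. -/
structure IsBraidedIdeal (r : σ → σ → σ → σ → k) (I : TwoSidedIdeal (FreeAlgebra k σ)) :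
    Prop where
  letterBraiding_mem : ∀ y ∈ I, ∀ i l, letterBraiding r y i l ∈ I
  wordBraiding_mem : ∀ y ∈ I, ∀ m j, wordBraiding r y m j ∈ I

variable {r : σ → σ → σ → σ → k} {I : TwoSidedIdeal (FreeAlgebra k σ)}

theorem IsBraidedIdeal.mulRightLetter_mem (hI : IsBraidedIdeal r I) (i : σ)
    {z : FreeAlgebra k σ ⊗[k] FreeAlgebra k σ} (hz : z ∈ tensorIdeal I) :
    mulRightLetter r i z ∈ tensorIdeal I := by
  refine tensorIdeal_le_comap (fun u hu v => ?_) (fun u v hv => ?_) hz <;>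
    rw [mulRightLetter_tmul] <;> refine Submodule.sum_mem _ fun l _ => ?_
  · exact tmul_mem_tensorIdeal_left (hI.letterBraiding_mem u hu i l) _
  · exact tmul_mem_tensorIdeal_right _ (I.mul_mem_left _ _ hv)

theorem IsBraidedIdeal.rightAction_mem (hI : IsBraidedIdeal r I) (y : FreeAlgebra k σ)
    {z : FreeAlgebra k σ ⊗[k] FreeAlgebra k σ} (hz : z ∈ tensorIdeal I) :
    rightAction r y z ∈ tensorIdeal I := by
  induction y using freeAlgebra_induction_left with
  | one => rwa [map_one]
  | add x y hx hy => rw [map_add]; exact add_mem hx hy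
  | smul s x hx => rw [map_smul]; exact Submodule.smul_mem _ _ hx
  | mul i x hx =>
    rw [map_mul, rightAction_ι]
    exact hI.mulRightLetter_mem i hx

theorem IsBraidedIdeal.rightAction_mem_of_mem (hI : IsBraidedIdeal r I) {y : FreeAlgebra k σ}
    (hy : y ∈ I) (z : FreeAlgebra k σ ⊗[k] FreeAlgebra k σ) :
    rightAction r y z ∈ tensorIdeal I := by
  induction z with
  | zero => simp
  | add u v hu hv => rw [map_add]; exact add_mem hu hv
  | tmul u v =>
    -- Move `1 ⊗ y` past the letters of `u`; each of them replaces `y` by entries of `wordBraiding`.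
    induction u using freeAlgebra_induction_left generalizing y with
    | one =>
      rw [rightAction_one_tmul]
      exact tmul_mem_tensorIdeal_right _ (I.mul_mem_right _ _ hy)
    | add u u' hu hu' => rw [TensorProduct.add_tmul, map_add]; exact add_mem (hu hy) (hu' hy)
    | smul s u hu => rw [← TensorProduct.smul_tmul', map_smul]; exact Submodule.smul_mem _ _ (hu hy)
    | mul j u hu =>
      rw [← mulLeftLetter_tmul, ← Module.End.mul_apply, rightAction_mul_mulLeftLetter,
        LinearMap.sum_apply]
      refine Submodule.sum_mem _ fun m _ => ?_
      rw [← leftAction_ι]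
      exact leftAction_mem_tensorIdeal _ (hu (hI.wordBraiding_mem y hy m j))

theorem IsBraidedIdeal.braidedMul_mem_right (hI : IsBraidedIdeal r I)
    (w : FreeAlgebra k σ ⊗[k] FreeAlgebra k σ) {z : FreeAlgebra k σ ⊗[k] FreeAlgebra k σ}
    (hz : z ∈ tensorIdeal I) : braidedMul r w z ∈ tensorIdeal I := by
  induction w with
  | zero => simp
  | tmul u v =>
    rw [braidedMul_tmul]
    exact leftAction_mem_tensorIdeal u (hI.rightAction_mem v hz)
  | add u v hu hv => rw [map_add]; exact add_mem hu hv

theorem IsBraidedIdeal.braidedMul_mem_left (hI : IsBraidedIdeal r I)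
    {w : FreeAlgebra k σ ⊗[k] FreeAlgebra k σ} (hw : w ∈ tensorIdeal I)
    (z : FreeAlgebra k σ ⊗[k] FreeAlgebra k σ) : braidedMul r w z ∈ tensorIdeal I := by
  have hle : tensorIdeal I ≤
      (tensorIdeal I).comap (LinearMap.applyₗ z ∘ₗ braidedMul r) := by
    refine tensorIdeal_le_comap (fun u hu v => ?_) (fun u v hv => ?_) <;>
      simp only [LinearMap.comp_apply, braidedMul_tmul, LinearMap.applyₗ_apply_apply,
        Module.End.mul_apply]
    · exact leftAction_mem_tensorIdeal_of_mem hu _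
    · exact leftAction_mem_tensorIdeal u (hI.rightAction_mem_of_mem hv z)
  exact hle hw

theorem map_matrix_mem_span {S : Set (FreeAlgebra k σ)}
    (f : FreeAlgebra k σ →ₐ[k] Matrix σ σ (FreeAlgebra k σ))
    (h : ∀ s ∈ S, ∀ i l, f s i l ∈ TwoSidedIdeal.span S) :
    ∀ y ∈ TwoSidedIdeal.span S, ∀ i l, f y i l ∈ TwoSidedIdeal.span S := by
  have hle : TwoSidedIdeal.span S ≤ ((TwoSidedIdeal.span S).matrix σ).comap f :=
    TwoSidedIdeal.span_le.mpr fun s hs => TwoSidedIdeal.mem_comap f |>.mpr fun i l => h s hs i l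
  exact fun y hy => (TwoSidedIdeal.mem_comap f).mp (hle hy)

theorem isHopfIdeal_span {S : Set (FreeAlgebra k σ)}
    (homogeneous : ∀ s ∈ S, ∃ n, 2 ≤ n ∧ s ∈ tensorPower k σ n)
    (braided : IsBraidedIdeal r (TwoSidedIdeal.span S))
    (primitive : ∀ s ∈ S, comul r s = s ⊗ₜ[k] 1 + 1 ⊗ₜ[k] s) :
    IsHopfIdeal r (TwoSidedIdeal.span S) where
  generated := by
    refine le_antisymm (TwoSidedIdeal.span_mono fun s hs => ?_)
      (TwoSidedIdeal.span_le.mpr fun x hx => hx.1)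
    exact ⟨TwoSidedIdeal.subset_span hs, homogeneous s hs⟩
  coideal x hx := by
    induction hx using TwoSidedIdeal.span_induction with
    | mem s hs =>
      rw [primitive s hs]
      exact add_mem (tmul_mem_tensorIdeal_left (TwoSidedIdeal.subset_span hs) 1)
        (tmul_mem_tensorIdeal_right 1 (TwoSidedIdeal.subset_span hs))
    | zero => rw [map_zero]; exact zero_mem _
    | add x y _ _ hx hy => rw [map_add]; exact add_mem hx hy
    | neg x _ hx => rw [map_neg]; exact neg_mem hx
    | left_absorb a x _ hx => rw [comul_mul]; exact braided.braidedMul_mem_right _ hx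
    | right_absorb b x _ hx => rw [comul_mul]; exact braided.braidedMul_mem_left hx _

end BraidedIdeals

section Quotients

variable {k : Type*} [Field k] {σ : Type*}

theorem mkₐ_eq_zero_iff {A : Type*} [Ring A] [Algebra k A] (I : TwoSidedIdeal A) {y : A} :
    I.ringCon.mkₐ k y = 0 ↔ y ∈ I := by
  conv_rhs => rw [← TwoSidedIdeal.ker_ringCon_mk' I, TwoSidedIdeal.mem_ker]
  rfl

theorem lift_mkₐ_ι (I : TwoSidedIdeal (FreeAlgebra k σ)) :
    FreeAlgebra.lift k (fun i => I.ringCon.mkₐ k (ι k i)) = I.ringCon.mkₐ k :=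
  FreeAlgebra.lift_comp_ι _

theorem lift_mkₐ_eq_zero {I : TwoSidedIdeal (FreeAlgebra k σ)} {S : Set (FreeAlgebra k σ)}
    (h : TwoSidedIdeal.span S ≤ I) :
    ∀ s ∈ S, FreeAlgebra.lift k (fun i => I.ringCon.mkₐ k (ι k i)) s = 0 := fun s hs => by
  rw [lift_mkₐ_ι, mkₐ_eq_zero_iff]
  exact h (TwoSidedIdeal.subset_span hs)

variable [DecidableEq σ] [Fintype σ] (r : σ → σ → σ → σ → k)

theorem isBraidedIdeal_span {S : Set (FreeAlgebra k σ)}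
    (letter : ∀ s ∈ S, FreeAlgebra.lift k (fun j => Matrix.of fun i l =>
      ∑ m, r i j m l • (TwoSidedIdeal.span S).ringCon.mkₐ k (ι k m)) s = 0)
    (word : ∀ s ∈ S, FreeAlgebra.lift k (fun i => Matrix.of fun m j =>
      ∑ l, r i j m l • (TwoSidedIdeal.span S).ringCon.mkₐ k (ι k l)) s = 0) :
    IsBraidedIdeal r (TwoSidedIdeal.span S) := by
  set π := (TwoSidedIdeal.span S).ringCon.mkₐ k
  have mem_of_comp_eq_zero (f : FreeAlgebra k σ →ₐ[k] Matrix σ σ (FreeAlgebra k σ))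
      (h : ∀ s ∈ S, π.mapMatrix.comp f s = 0) :
      ∀ y ∈ TwoSidedIdeal.span S, ∀ i l, f y i l ∈ TwoSidedIdeal.span S :=
    map_matrix_mem_span f fun s hs i l =>
      (mkₐ_eq_zero_iff (k := k) _).mp (Matrix.ext_iff.mpr (h s hs) i l)
  refine ⟨mem_of_comp_eq_zero _ fun s hs => ?_, mem_of_comp_eq_zero _ fun s hs => ?_⟩
  · rw [← letter s hs]
    congr 1
    ext j i l
    simp [letterBraiding_ι]
  · rw [← word s hs]
    congr 1
    ext i m j
    simp [wordBraiding_ι]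

theorem comul_ι_mul_ι (i j : σ) :
    comul r (ι k i * ι k j) = (ι k i * ι k j) ⊗ₜ[k] 1 + ι k i ⊗ₜ[k] ι k j +
      ∑ l, ∑ m, r i j m l • (ι k m ⊗ₜ[k] ι k l) + 1 ⊗ₜ[k] (ι k i * ι k j) := by
  have comul_ι : comul r (ι k j) = ι k j ⊗ₜ[k] 1 + 1 ⊗ₜ[k] ι k j := by
    simpa [comul_one, mulLeftLetter_tmul, mulRightLetter_tmul, Matrix.one_apply,
      TensorProduct.ite_tmul] using comul_ι_mul r j 1
  simp only [comul_ι_mul, comul_ι, map_add, mulLeftLetter_tmul, mulRightLetter_tmul,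
    letterBraiding_ι, map_one, Matrix.one_apply, TensorProduct.ite_tmul, Finset.sum_ite_eq,
    Finset.mem_univ, if_true, mul_one, TensorProduct.sum_tmul, TensorProduct.smul_tmul']
  abel

end Quotients

section Relations

variable {k : Type*} [Field k]

/-- The relations of the Nichols algebra for `t = 1`, as rules which rewrite a product of letters
in terms of ordered products. -/
structure SymmetricRelations {A : Type*} [Ring A] [Algebra k A] (a b : k) (x : Fin 3 → A) :
    Prop where
  one_mul_zero : x 1 * x 0 = x 0 * x 1
  two_mul_zero : x 2 * x 0 = x 0 * x 2 + a • (x 0 * x 0)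
  two_mul_one : x 2 * x 1 = x 1 * x 2 + (2 * a - b) • (x 0 * x 1)

/-- The relations of the Nichols algebra for `t = -1`, as rules which rewrite a product of letters
in terms of strictly ordered products. -/
structure ExteriorRelations {A : Type*} [Ring A] [Algebra k A] (b p : k) (x : Fin 3 → A) :
    Prop where
  one_mul_zero : x 1 * x 0 = -(x 0 * x 1)
  two_mul_zero : x 2 * x 0 = -(x 0 * x 2)
  two_mul_one : x 2 * x 1 = b • (x 0 * x 1) - x 1 * x 2
  zero_mul_zero : x 0 * x 0 = 0
  one_mul_one : x 1 * x 1 = 0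
  two_mul_two : x 2 * x 2 = b • (x 0 * x 2) - p • (x 0 * x 1)

variable {A : Type*} [Ring A] [Algebra k A] {a b p : k} {x : Fin 3 → A}

theorem lift_relationsOne :
    (∀ s ∈ relationsOne a b, FreeAlgebra.lift k x s = 0) ↔ SymmetricRelations a b x := by
  simp only [relationsOne, Set.mem_insert_iff, Set.mem_singleton_iff, forall_eq_or_imp, forall_eq,
    map_add, map_sub, map_mul, map_smul, FreeAlgebra.lift_ι_apply, sq]
  constructor
  · rintro ⟨h10, h20, h21⟩
    refine ⟨?_, ?_, ?_⟩ <;> rw [← sub_eq_zero]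
    · exact h10
    · rw [← h20]; module
    · rw [← h21]; module
  · rintro ⟨h10, h20, h21⟩
    refine ⟨?_, ?_, ?_⟩
    · rw [h10, sub_self]
    · rw [h20]; module
    · rw [h21]; module

theorem lift_relationsMinusOne :
    (∀ s ∈ relationsMinusOne b p, FreeAlgebra.lift k x s = 0) ↔ ExteriorRelations b p x := by
  simp only [relationsMinusOne, Set.mem_insert_iff, Set.mem_singleton_iff, forall_eq_or_imp,
    forall_eq, map_add, map_sub, map_mul, map_smul, FreeAlgebra.lift_ι_apply, sq]
  constructor
  · rintro ⟨h10, h20, h21, h00, h11, h22⟩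
    refine ⟨?_, ?_, ?_, h00, h11, ?_⟩ <;> rw [← sub_eq_zero]
    · rw [← h10]; module
    · rw [← h20]; module
    · rw [← h21]; module
    · rw [← h22]; module
  · rintro ⟨h10, h20, h21, h00, h11, h22⟩
    refine ⟨?_, ?_, ?_, h00, h11, ?_⟩
    · rw [h10]; module
    · rw [h20]; module
    · rw [h21]; module
    · rw [h22]; module

/-- The matrices `letterBraiding (braidingR11 t a b p) (x_j)`, with entries in any algebra. -/
def letterMatrix (t a b p : k) (x : Fin 3 → A) : Fin 3 → Matrix (Fin 3) (Fin 3) A :=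
  ![!![t • x 0, 0, 0;
       0, t • x 0, 0;
       (t * a) • x 0, 0, t • x 0],
    !![t • x 1, 0, 0;
       0, t • x 1, 0;
       (t * a) • x 1, (t * (a - b)) • x 0, t • x 1],
    !![t • x 2 - (t * a) • x 0, 0, 0;
       (t * (b - a)) • x 1, t • x 2 - (t * a) • x 0, 0;
       (t * b) • x 2 - (t * a * b) • x 0 - (t * p) • x 1, (t * p) • x 0,
         t • x 2 - (t * b) • x 0]]

/-- The matrices `wordBraiding (braidingR11 t a b p) (x_i)`, with entries in any algebra. -/
def wordMatrix (t a b p : k) (x : Fin 3 → A) : Fin 3 → Matrix (Fin 3) (Fin 3) A :=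
  ![!![t • x 0, 0, -((t * a) • x 0);
       0, t • x 0, 0;
       0, 0, t • x 0],
    !![t • x 1, 0, -((t * a) • x 1);
       0, t • x 1, (t * (b - a)) • x 0;
       0, 0, t • x 1],
    !![t • x 2 + (t * a) • x 0, (t * (a - b)) • x 1,
         (t * p) • x 1 - (t * b) • x 2 - (t * a * b) • x 0;
       0, t • x 2 + (t * a) • x 0, -((t * p) • x 0);
       0, 0, t • x 2 + (t * b) • x 0]]

theorem sum_braidingR11_smul_letter (t a b p : k) (x : Fin 3 → A) :
    (fun j => Matrix.of fun i l => ∑ m, braidingR11 t a b p i j m l • x m) =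
      letterMatrix t a b p x := by
  ext j i l
  rw [Matrix.of_apply, Fin.sum_univ_three]
  fin_cases j <;> fin_cases i <;> fin_cases l <;>
    simp only [braidingR11, letterMatrix, Matrix.of_apply, Matrix.cons_val, Fin.mk_zero, Fin.mk_one,
      Fin.reduceFinMk, zero_smul, add_zero, zero_add]
  all_goals module

theorem sum_braidingR11_smul_word (t a b p : k) (x : Fin 3 → A) :
    (fun i => Matrix.of fun m j => ∑ l, braidingR11 t a b p i j m l • x l) =
      wordMatrix t a b p x := by
  ext i m j
  rw [Matrix.of_apply, Fin.sum_univ_three]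
  fin_cases i <;> fin_cases m <;> fin_cases j <;>
    simp only [braidingR11, wordMatrix, Matrix.of_apply, Matrix.cons_val, Fin.mk_zero, Fin.mk_one,
      Fin.reduceFinMk, zero_smul, add_zero, zero_add]
  all_goals module

theorem SymmetricRelations.letterMatrix (H : SymmetricRelations a b x) :
    SymmetricRelations a b (letterMatrix 1 a b p x) := by
  constructor <;>
  · ext i l
    fin_cases i <;> fin_cases l <;>
    · simp only [BraidedNichols.letterMatrix, Matrix.mul_apply, Fin.sum_univ_three, Matrix.of_apply,
        Matrix.cons_val, Matrix.add_apply, Matrix.smul_apply, Fin.mk_zero, Fin.mk_one,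
        Fin.reduceFinMk, mul_zero, zero_mul, add_zero, zero_add, smul_zero, one_mul, one_smul,
        mul_sub, sub_mul, mul_smul_comm, smul_mul_assoc, smul_add, smul_sub, H.one_mul_zero,
        H.two_mul_zero, H.two_mul_one]
      try module

theorem SymmetricRelations.wordMatrix (H : SymmetricRelations a b x) :
    SymmetricRelations a b (wordMatrix 1 a b p x) := by
  constructor <;>
  · ext i l
    fin_cases i <;> fin_cases l <;>
    · simp only [BraidedNichols.wordMatrix, Matrix.mul_apply, Fin.sum_univ_three, Matrix.of_apply,
        Matrix.cons_val, Matrix.add_apply, Matrix.smul_apply, Fin.mk_zero, Fin.mk_one,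
        Fin.reduceFinMk, mul_zero, zero_mul, add_zero, zero_add, smul_zero, neg_zero, one_mul,
        one_smul, mul_add, add_mul, mul_sub, sub_mul, mul_smul_comm, smul_mul_assoc, neg_mul,
        mul_neg, smul_add, smul_neg, H.one_mul_zero, H.two_mul_zero, H.two_mul_one]
      try module

theorem ExteriorRelations.letterMatrix (H : ExteriorRelations b p x) :
    ExteriorRelations b p (letterMatrix (-1) a b p x) := by
  constructor <;>
  · ext i l
    fin_cases i <;> fin_cases l <;>
    · simp only [BraidedNichols.letterMatrix, Matrix.mul_apply, Fin.sum_univ_three, Matrix.of_apply,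
        Matrix.cons_val, Matrix.sub_apply, Matrix.neg_apply, Matrix.zero_apply, Matrix.smul_apply,
        Fin.mk_zero, Fin.mk_one, Fin.reduceFinMk, mul_zero, zero_mul, add_zero, zero_add, smul_zero,
        neg_zero, one_mul, one_smul, neg_smul, mul_sub, sub_mul, mul_smul_comm, smul_mul_assoc,
        neg_mul, mul_neg, smul_add, smul_neg, smul_sub, H.one_mul_zero, H.two_mul_zero,
        H.two_mul_one, H.zero_mul_zero, H.one_mul_one, H.two_mul_two]
      try module

theorem ExteriorRelations.wordMatrix (H : ExteriorRelations b p x) :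
    ExteriorRelations b p (wordMatrix (-1) a b p x) := by
  constructor <;>
  · ext i l
    fin_cases i <;> fin_cases l <;>
    · simp only [BraidedNichols.wordMatrix, Matrix.mul_apply, Fin.sum_univ_three, Matrix.of_apply,
        Matrix.cons_val, Matrix.sub_apply, Matrix.neg_apply, Matrix.zero_apply, Matrix.smul_apply,
        Fin.mk_zero, Fin.mk_one, Fin.reduceFinMk, mul_zero, zero_mul, add_zero, zero_add, smul_zero,
        neg_zero, one_mul, one_smul, neg_smul, mul_add, add_mul, mul_sub, sub_mul, mul_smul_comm,
        smul_mul_assoc, neg_mul, mul_neg, smul_add, smul_neg, smul_sub, H.one_mul_zero,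
        H.two_mul_zero, H.two_mul_one, H.zero_mul_zero, H.one_mul_one, H.two_mul_two]
      try module

theorem X_mul_X_mem (i j : Fin 3) : (X i * X j : FreeAlgebra k (Fin 3)) ∈ tensorPower k (Fin 3) 2 :=
  ι_mul_mem_tensorPower i (ι_mem_tensorPower_one j)

theorem relationsOne_subset_tensorPower :
    relationsOne a b ⊆ (tensorPower k (Fin 3) 2 : Set _) := by
  rintro s (rfl | rfl | rfl) <;> simp only [SetLike.mem_coe, sq] <;>
    apply_rules [add_mem, sub_mem, Submodule.smul_mem, X_mul_X_mem]

theorem relationsMinusOne_subset_tensorPower :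
    relationsMinusOne b p ⊆ (tensorPower k (Fin 3) 2 : Set _) := by
  rintro s (rfl | rfl | rfl | rfl | rfl | rfl) <;> simp only [SetLike.mem_coe, sq] <;>
    apply_rules [add_mem, sub_mem, Submodule.smul_mem, X_mul_X_mem]

theorem comul_relationsOne {s : FreeAlgebra k (Fin 3)} (hs : s ∈ relationsOne a b) :
    comul (braidingR11 1 a b p) s = s ⊗ₜ[k] 1 + 1 ⊗ₜ[k] s := by
  rcases hs with rfl | rfl | rfl <;>
  · simp only [sq, map_add, map_sub, map_smul, comul_ι_mul_ι, Fin.sum_univ_three, braidingR11,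
      Matrix.of_apply, Matrix.cons_val, TensorProduct.add_tmul, TensorProduct.tmul_add,
      TensorProduct.sub_tmul, TensorProduct.tmul_sub, ← TensorProduct.smul_tmul',
      TensorProduct.tmul_smul]
    module

theorem comul_relationsMinusOne {s : FreeAlgebra k (Fin 3)} (hs : s ∈ relationsMinusOne b p) :
    comul (braidingR11 (-1) a b p) s = s ⊗ₜ[k] 1 + 1 ⊗ₜ[k] s := by
  rcases hs with rfl | rfl | rfl | rfl | rfl | rfl <;>
  · simp only [sq, map_add, map_sub, map_smul, comul_ι_mul_ι, Fin.sum_univ_three, braidingR11,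
      Matrix.of_apply, Matrix.cons_val, TensorProduct.add_tmul, TensorProduct.tmul_add,
      TensorProduct.sub_tmul, TensorProduct.tmul_sub, ← TensorProduct.smul_tmul',
      TensorProduct.tmul_smul]
    module

theorem isHopfIdeal_relationsOne (a b p : k) :
    IsHopfIdeal (braidingR11 1 a b p) (TwoSidedIdeal.span (relationsOne a b)) := by
  have H := lift_relationsOne.mp (lift_mkₐ_eq_zero (S := relationsOne a b) le_rfl)
  exact isHopfIdeal_span (fun s hs => ⟨2, le_rfl, relationsOne_subset_tensorPower hs⟩)
    (isBraidedIdeal_span _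
      (by rw [sum_braidingR11_smul_letter]; exact lift_relationsOne.mpr H.letterMatrix)
      (by rw [sum_braidingR11_smul_word]; exact lift_relationsOne.mpr H.wordMatrix))
    fun s hs => comul_relationsOne hs

theorem isHopfIdeal_relationsMinusOne (a b p : k) :
    IsHopfIdeal (braidingR11 (-1) a b p) (TwoSidedIdeal.span (relationsMinusOne b p)) := by
  have H := lift_relationsMinusOne.mp (lift_mkₐ_eq_zero (S := relationsMinusOne b p) le_rfl)
  exact isHopfIdeal_span (fun s hs => ⟨2, le_rfl, relationsMinusOne_subset_tensorPower hs⟩)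
    (isBraidedIdeal_span _
      (by rw [sum_braidingR11_smul_letter]; exact lift_relationsMinusOne.mpr H.letterMatrix)
      (by rw [sum_braidingR11_smul_word]; exact lift_relationsMinusOne.mpr H.wordMatrix))
    fun s hs => comul_relationsMinusOne hs

end Relations

section QFactorial

variable {k : Type*} [CommRing k]

/-- The `t`-number `1 + t + ⋯ + t ^ (n - 1)`. -/
def qNumber (t : k) (n : ℕ) : k := ∑ i ∈ Finset.range n, t ^ i

/-- The `t`-factorial, the product of the `t`-numbers of `1, …, n`. -/
def qFactorial (t : k) (n : ℕ) : k := ∏ i ∈ Finset.range n, qNumber t (i + 1)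

theorem qNumber_succ (t : k) (n : ℕ) : qNumber t (n + 1) = qNumber t n + t ^ n :=
  Finset.sum_range_succ _ _

theorem qFactorial_succ (t : k) (n : ℕ) :
    qFactorial t (n + 1) = qFactorial t n * qNumber t (n + 1) :=
  Finset.prod_range_succ _ _

theorem qFactorial_zero (t : k) : qFactorial t 0 = 1 := Finset.prod_range_zero _

theorem qFactorial_of_le_one (t : k) {n : ℕ} (hn : n ≤ 1) : qFactorial t n = 1 := by
  interval_cases n <;> simp [qFactorial, qNumber]

theorem qFactorial_one_left (n : ℕ) : qFactorial (1 : k) n = n.factorial := by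
  simp [qFactorial, qNumber, ← Finset.prod_range_add_one_eq_factorial]

end QFactorial

section LinearIndependence

theorem linearIndependent_of_triangular {R α κ M N : Type*} [CommRing R] [NoZeroDivisors R]
    [LinearOrder κ] [AddCommGroup M] [Module R M] [AddCommGroup N] [Module R N] {key : α → κ}
    (key_injective : Function.Injective key) (f : M →ₗ[R] N) (v : α → M) (φ : α → Module.Dual R M)
    (ker_le : ∀ i, LinearMap.ker f ≤ LinearMap.ker (φ i))
    (upper : ∀ i j, key j < key i → φ i (v j) = 0) (diagonal : ∀ i, φ i (v i) ≠ 0) :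
    LinearIndependent R fun i => f (v i) := by
  classical
  rw [linearIndependent_iff']
  intro s c hc
  by_contra! hne
  obtain ⟨j, hj, hcj⟩ := hne
  obtain ⟨i, hi, hmax⟩ := Finset.exists_max_image (s.filter fun i => c i ≠ 0) key
    ⟨j, Finset.mem_filter.mpr ⟨hj, hcj⟩⟩
  rw [Finset.mem_filter] at hi
  have sum_mem_ker : ∑ j ∈ s, c j • v j ∈ LinearMap.ker f := by simpa using hc
  have apply_sum : φ i (∑ j ∈ s, c j • v j) = c i * φ i (v i) := by
    simp only [map_sum, map_smul, smul_eq_mul]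
    refine Finset.sum_eq_single_of_mem i hi.1 fun j hj hji => ?_
    by_cases hcj : c j = 0
    · rw [hcj, zero_mul]
    · have key_le := hmax j (Finset.mem_filter.mpr ⟨hj, hcj⟩)
      rw [upper i j (key_le.lt_of_ne (key_injective.ne hji)), mul_zero]
  exact mul_ne_zero hi.2 (diagonal i) (apply_sum ▸ ker_le i sum_mem_ker)

variable {k : Type*} [Field k] {σ : Type*} [DecidableEq σ]

/-- The algebra map `T(V) → k` with `x_l ↦ 1` which kills the other letters. -/
def letterCharacter (l : σ) : FreeAlgebra k σ →ₐ[k] k :=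
  FreeAlgebra.lift k (Pi.single l 1)

theorem letterCharacter_ι (l i : σ) :
    letterCharacter l (ι k i) = if i = l then (1 : k) else 0 := by
  simp [letterCharacter, Pi.single_apply]

variable [Fintype σ] {r : σ → σ → σ → σ → k}

theorem letterBraiding_blockTriangular [LinearOrder σ]
    (hr : ∀ i j m l, i < l → r i j m l = 0) (y : FreeAlgebra k σ) :
    (letterBraiding r y).BlockTriangular OrderDual.toDual := by
  induction y using freeAlgebra_induction_left with
  | one => rw [map_one]; exact Matrix.blockTriangular_one
  | add x y hx hy => rw [map_add]; exact hx.add hy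
  | smul s x hx => rw [map_smul]; exact fun i l h => by rw [Matrix.smul_apply, hx h, smul_zero]
  | mul j x hx =>
    rw [map_mul]
    refine Matrix.BlockTriangular.mul (fun i l hil => ?_) hx
    rw [letterBraiding_ι]
    exact Finset.sum_eq_zero fun m _ => by rw [hr i j m l hil, zero_smul]

theorem commute_skewDeriv_mulLeft {i l : σ} (h : ∀ y, letterBraiding r y i l = 0) :
    Commute (skewDeriv r l) (LinearMap.mulLeft k (ι k i)) :=
  LinearMap.ext fun y => by simp [skewDeriv_ι_mul, h]

theorem skewDeriv_pow_ι_pow_mul {i l : σ} (h : ∀ y, letterBraiding r y i l = 0) (m n : ℕ)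
    (y : FreeAlgebra k σ) :
    (skewDeriv r l ^ n) (ι k i ^ m * y) = ι k i ^ m * (skewDeriv r l ^ n) y := by
  simpa [LinearMap.pow_mulLeft] using
    LinearMap.congr_fun ((commute_skewDeriv_mulLeft h).pow_pow n m) y

theorem letterBraiding_ι_pow_self {l : σ} {t : k}
    (hr : ∀ m i, r l l m i = if m = l ∧ i = l then t else 0) (n : ℕ) :
    letterBraiding r (ι k l ^ n) l l = t ^ n • ι k l ^ n := by
  induction n with
  | zero => simp
  | succ n ih =>
    have letterBraiding_self (i : σ) :
        letterBraiding r (ι k l) l i = if i = l then t • ι k l else 0 := by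
      simp [letterBraiding_ι, hr, ite_and, ite_smul]
    rw [pow_succ', map_mul, Matrix.mul_apply]
    simp only [letterBraiding_self, ite_mul, zero_mul, Finset.sum_ite_eq', Finset.mem_univ, if_true]
    rw [ih, smul_mul_smul_comm, pow_succ']

theorem skewDeriv_ι_pow_succ {l : σ} {t : k}
    (hr : ∀ m i, r l l m i = if m = l ∧ i = l then t else 0) (n : ℕ) :
    skewDeriv r l (ι k l ^ (n + 1)) = qNumber t (n + 1) • ι k l ^ n := by
  induction n with
  | zero => simp [skewDeriv_ι, qNumber]
  | succ n ih =>
    rw [pow_succ', skewDeriv_ι_mul, ih, letterBraiding_ι_pow_self hr, mul_smul_comm, ← pow_succ',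
      qNumber_succ t (n + 1), add_smul]

theorem skewDeriv_pow_ι_pow {l : σ} {t : k}
    (hr : ∀ m i, r l l m i = if m = l ∧ i = l then t else 0) (n : ℕ) :
    (skewDeriv r l ^ n) (ι k l ^ n) = qFactorial t n • 1 := by
  induction n with
  | zero => simp [qFactorial_zero]
  | succ n ih =>
    rw [pow_succ, Module.End.mul_apply, skewDeriv_ι_pow_succ hr, map_smul, ih, smul_smul,
      qFactorial_succ, mul_comm]

theorem letterCharacter_letterBraiding {l : σ} {t : k}
    (vanish : ∀ i, i ≠ l → ∀ y, letterBraiding r y i l = 0)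
    (hr : ∀ j, r l j l l = if j = l then t else 0) {n : ℕ} {y : FreeAlgebra k σ}
    (hy : y ∈ tensorPower k σ n) :
    letterCharacter l (letterBraiding r y l l) = t ^ n * letterCharacter l y := by
  let φ : FreeAlgebra k σ →ₗ[k] k := (letterCharacter l).toLinearMap ∘ₗ
    Matrix.entryLinearMap k _ l l ∘ₗ (letterBraiding r).toLinearMap
  suffices tensorPower k σ n ≤ LinearMap.eqLocus φ (t ^ n • (letterCharacter l).toLinearMap) from
    this hy
  clear hy
  induction n with
  | zero => exact tensorPower_zero_le (by simp [φ])
  | succ n ih =>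
    refine tensorPower_succ_le fun j x hx => ?_
    have ih : letterCharacter l (letterBraiding r x l l) = t ^ n * letterCharacter l x := ih hx
    have letter : letterCharacter l (letterBraiding r (ι k j) l l) = if j = l then t else 0 := by
      simp [letterBraiding_ι, letterCharacter_ι, hr]
    have mul_entry : letterBraiding r (ι k j * x) l l =
        letterBraiding r (ι k j) l l * letterBraiding r x l l := by
      rw [map_mul, Matrix.mul_apply]
      exact Finset.sum_eq_single_of_mem l (Finset.mem_univ l) fun m _ hm => by
        rw [vanish m hm, mul_zero]
    change letterCharacter l (letterBraiding r (ι k j * x) l l) =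
      t ^ (n + 1) * letterCharacter l (ι k j * x)
    rw [mul_entry, map_mul, letter, ih, map_mul, letterCharacter_ι]
    split_ifs <;> ring

theorem letterCharacter_skewDeriv {l : σ} {t : k}
    (vanish : ∀ i, i ≠ l → ∀ y, letterBraiding r y i l = 0)
    (hr : ∀ j, r l j l l = if j = l then t else 0) {n : ℕ} {y : FreeAlgebra k σ}
    (hy : y ∈ tensorPower k σ n) :
    letterCharacter l (skewDeriv r l y) = qNumber t n * letterCharacter l y := by
  suffices tensorPower k σ n ≤ LinearMap.eqLocus ((letterCharacter l).toLinearMap ∘ₗ skewDeriv r l)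
      (qNumber t n • (letterCharacter l).toLinearMap) from this hy
  clear hy
  induction n with
  | zero => exact tensorPower_zero_le (by simp [skewDeriv_one, qNumber])
  | succ n ih =>
    refine tensorPower_succ_le fun j x hx => ?_
    have ih : letterCharacter l (skewDeriv r l x) = qNumber t n * letterCharacter l x := ih hx
    change letterCharacter l (skewDeriv r l (ι k j * x)) =
      qNumber t (n + 1) * letterCharacter l (ι k j * x)
    rw [skewDeriv_ι_mul, map_add, map_mul, map_mul, ih, letterCharacter_ι]
    split_ifs with hj
    · rw [hj, letterCharacter_letterBraiding vanish hr hx, qNumber_succ]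
      ring
    · rw [vanish j hj, map_zero]
      ring

theorem skewDeriv_pow_of_mem_tensorPower {l : σ} {t : k}
    (vanish : ∀ i, i ≠ l → ∀ y, letterBraiding r y i l = 0)
    (hr : ∀ j, r l j l l = if j = l then t else 0) {n : ℕ} {y : FreeAlgebra k σ}
    (hy : y ∈ tensorPower k σ n) :
    (skewDeriv r l ^ n) y = (qFactorial t n * letterCharacter l y) • 1 := by
  induction n generalizing y with
  | zero =>
    exact tensorPower_zero_le (p := LinearMap.eqLocus (skewDeriv r l ^ 0)
      ((qFactorial t 0 • (letterCharacter l).toLinearMap).smulRight 1))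
      (by simp [qFactorial_zero]) hy
  | succ n ih =>
    rw [pow_succ, Module.End.mul_apply, ih (skewDeriv_mem_tensorPower r l hy),
      letterCharacter_skewDeriv vanish hr hy, qFactorial_succ, mul_assoc]

end LinearIndependence

section OrderedProducts

/-- The ordered monomial `x_1^{e_1} x_2^{e_2} x_3^{e_3}` in elements of an arbitrary monoid. -/
def orderedProduct {A : Type*} [Monoid A] (x : Fin 3 → A) (e : Fin 3 → ℕ) : A :=
  x 0 ^ e 0 * x 1 ^ e 1 * x 2 ^ e 2

theorem map_orderedProduct {A B F : Type*} [Monoid A] [Monoid B] [FunLike F A B]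
    [MonoidHomClass F A B] (f : F) (x : Fin 3 → A) (e : Fin 3 → ℕ) :
    f (orderedProduct x e) = orderedProduct (f ∘ x) e := by
  simp [orderedProduct]

/-- The exponents of an ordered monomial, reordered so that the lexicographic order compares the
exponents of `x_3`, `x_2`, `x_1` in turn. -/
def exponentKey (e : Fin 3 → ℕ) : ℕ ×ₗ ℕ ×ₗ ℕ := toLex (e 2, toLex (e 1, e 0))

theorem exponentKey_injective : Function.Injective exponentKey := by
  intro e e' h
  simp only [exponentKey, EmbeddingLike.apply_eq_iff_eq, Prod.mk.injEq] at h
  funext i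
  fin_cases i
  exacts [h.2.2, h.2.1, h.1]

variable {k : Type*} [Field k] {t a b p : k}

theorem letterBraiding_R11_eq_zero {i l : Fin 3} (hil : i < l) (y : FreeAlgebra k (Fin 3)) :
    letterBraiding (braidingR11 t a b p) y i l = 0 := by
  refine letterBraiding_blockTriangular (fun i j m l hil => ?_) y hil
  fin_cases i <;> fin_cases l <;> first
  | exact absurd hil (by decide)
  | fin_cases j <;> fin_cases m <;> rfl

theorem skewDeriv_pow_X_pow (l : Fin 3) (n : ℕ) :
    (skewDeriv (braidingR11 t a b p) l ^ n) (X l ^ n) = qFactorial t n • 1 := by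
  have pow_of_diagonal (l : Fin 3)
      (hr : ∀ m i, braidingR11 t a b p l l m i = if m = l ∧ i = l then t else 0) :
      (skewDeriv (braidingR11 t a b p) l ^ n) (X l ^ n) = qFactorial t n • 1 :=
    skewDeriv_pow_ι_pow hr n
  match l with
  | 0 => exact pow_of_diagonal 0 fun m i => by fin_cases m <;> fin_cases i <;> rfl
  | 1 => exact pow_of_diagonal 1 fun m i => by fin_cases m <;> fin_cases i <;> rfl
  | 2 =>
    -- `c (x_3 ⊗ x_3)` is not a multiple of `x_3 ⊗ x_3`, but the other terms of `∂_3 (x_3 ^ n)` are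
    -- killed by the character `x_3 ↦ 1`, and `∂_3 ^ n (x_3 ^ n)` is a scalar.
    rw [skewDeriv_pow_of_mem_tensorPower (t := t)
      (fun i hi => letterBraiding_R11_eq_zero (lt_of_le_of_ne (by omega) hi))
      (fun j => by fin_cases j <;> rfl) (ι_pow_mem_tensorPower 2 n)]
    simp [letterCharacter_ι]

variable (t a b p) in
/-- The functional `ε ∂_1^{e_1} ∂_2^{e_2} ∂_3^{e_3}`, which detects the ordered monomial with
exponents `e` among those of smaller or equal `exponentKey`. -/
def derivFunctional (e : Fin 3 → ℕ) : Module.Dual k (FreeAlgebra k (Fin 3)) :=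
  algebraMapInv.toLinearMap ∘ₗ orderedProduct (skewDeriv (braidingR11 t a b p)) e

theorem derivFunctional_eq_zero (e : Fin 3 → ℕ) {y : FreeAlgebra k (Fin 3)}
    (hy : y ∈ nicholsIdeal (braidingR11 t a b p)) : derivFunctional t a b p e y = 0 := by
  have J := isHopfIdeal_nicholsIdeal (braidingR11 t a b p)
  exact J.algebraMapInv_eq_zero <| J.skewDeriv_pow_mem 0 _ <| J.skewDeriv_pow_mem 1 _ <|
    J.skewDeriv_pow_mem 2 _ hy

theorem skewDeriv_two_pow_orderedProduct (n : ℕ) (e : Fin 3 → ℕ) :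
    (skewDeriv (braidingR11 t a b p) 2 ^ n) (orderedProduct X e) =
      X 0 ^ e 0 * (X 1 ^ e 1 * (skewDeriv (braidingR11 t a b p) 2 ^ n) (X 2 ^ e 2)) := by
  rw [orderedProduct, mul_assoc,
    skewDeriv_pow_ι_pow_mul (letterBraiding_R11_eq_zero (by decide)),
    skewDeriv_pow_ι_pow_mul (letterBraiding_R11_eq_zero (by decide))]

theorem skewDeriv_one_pow_mul (n i j : ℕ) :
    (skewDeriv (braidingR11 t a b p) 1 ^ n) (X 0 ^ i * X 1 ^ j) =
      X 0 ^ i * (skewDeriv (braidingR11 t a b p) 1 ^ n) (X 1 ^ j) :=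
  skewDeriv_pow_ι_pow_mul (letterBraiding_R11_eq_zero (by decide)) _ _ _

theorem derivFunctional_orderedProduct_of_lt {e e' : Fin 3 → ℕ}
    (h : exponentKey e' < exponentKey e) :
    derivFunctional t a b p e (orderedProduct X e') = 0 := by
  have pow_eq_zero (l : Fin 3) (hl : e' l < e l) :
      (skewDeriv (braidingR11 t a b p) l ^ e l) (X l ^ e' l) = 0 :=
    skewDeriv_pow_eq_zero _ l hl (ι_pow_mem_tensorPower l _)
  rw [derivFunctional, LinearMap.comp_apply, orderedProduct, Module.End.mul_apply,
    Module.End.mul_apply, skewDeriv_two_pow_orderedProduct]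
  rw [exponentKey, exponentKey, Prod.Lex.toLex_lt_toLex, Prod.Lex.toLex_lt_toLex] at h
  rcases h with h2 | ⟨h2, h1 | ⟨h1, h0⟩⟩
  · simp [pow_eq_zero 2 h2]
  · simp only at h2
    simp [h2, skewDeriv_pow_X_pow, skewDeriv_one_pow_mul, pow_eq_zero 1 h1]
  · simp only at h1 h2
    simp [h1, h2, skewDeriv_pow_X_pow, skewDeriv_one_pow_mul, pow_eq_zero 0 h0]

theorem derivFunctional_orderedProduct_self (e : Fin 3 → ℕ) :
    derivFunctional t a b p e (orderedProduct X e) =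
      qFactorial t (e 2) * qFactorial t (e 1) * qFactorial t (e 0) := by
  rw [derivFunctional, LinearMap.comp_apply, orderedProduct, Module.End.mul_apply,
    Module.End.mul_apply, skewDeriv_two_pow_orderedProduct]
  simp [skewDeriv_pow_X_pow, skewDeriv_one_pow_mul, mul_assoc]

theorem mkₐ_orderedProduct (r : Fin 3 → Fin 3 → Fin 3 → Fin 3 → k) (e : Fin 3 → ℕ) :
    (nicholsIdeal r).ringCon.mkₐ k (orderedProduct X e) = orderedMonomial r e :=
  map_orderedProduct _ X e

theorem linearIndependent_orderedMonomial {α : Type*} {f : α → Fin 3 → ℕ}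
    (hf : Function.Injective f) (h : ∀ i l, qFactorial t (f i l) ≠ 0) :
    LinearIndependent k fun i => orderedMonomial (braidingR11 t a b p) (f i) := by
  simp_rw [← mkₐ_orderedProduct]
  refine linearIndependent_of_triangular (exponentKey_injective.comp hf)
    ((nicholsIdeal (braidingR11 t a b p)).ringCon.mkₐ k).toLinearMap
    (fun i => orderedProduct X (f i)) (fun i => derivFunctional t a b p (f i)) ?_ ?_ ?_
  · exact fun i y hy => derivFunctional_eq_zero _ ((mkₐ_eq_zero_iff (k := k) _).mp hy)
  · exact fun i j hij => derivFunctional_orderedProduct_of_lt hij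
  · intro i
    rw [derivFunctional_orderedProduct_self]
    exact mul_ne_zero (mul_ne_zero (h i 2) (h i 1)) (h i 0)

end OrderedProducts

section Straightening

variable {k : Type*} [Field k] {A : Type*} [Ring A] [Algebra k A]

theorem prod_map_mem_span_isChain {σ : Type*} [LinearOrder σ] [WellFoundedLT σ]
    {R : σ → σ → Prop} {x : σ → A}
    (straighten : ∀ i j, ¬R i j →
      x i * x j ∈ Submodule.span k {z | ∃ m l, toLex (m, l) < toLex (i, j) ∧ x m * x l = z})
    (w : List σ) :
    (w.map x).prod ∈ Submodule.span k
      {z | ∃ v : List σ, v.IsChain R ∧ v.length = w.length ∧ (v.map x).prod = z} := by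
  induction w using (List.Shortlex.wf (wellFounded_lt (α := σ))).induction with
  | _ w ih =>
  by_cases hw : w.IsChain R
  · exact Submodule.subset_span ⟨w, hw, rfl, rfl⟩
  rw [List.isChain_iff_forall_rel_of_append_cons_cons] at hw
  push Not at hw
  obtain ⟨i, j, u, v, rfl, hij⟩ := hw
  set W := Submodule.span k {z | ∃ v' : List σ, v'.IsChain R ∧
    v'.length = (u ++ i :: j :: v).length ∧ (v'.map x).prod = z}
  let insertBetween : A →ₗ[k] A :=
    LinearMap.mulLeft k (u.map x).prod ∘ₗ LinearMap.mulRight k (v.map x).prod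
  have insertBetween_apply (m l : σ) :
      insertBetween (x m * x l) = ((u ++ m :: l :: v).map x).prod := by
    simp [insertBetween, mul_assoc]
  suffices Submodule.span k {z | ∃ m l, toLex (m, l) < toLex (i, j) ∧ x m * x l = z} ≤
      W.comap insertBetween from insertBetween_apply i j ▸ this (straighten i j hij)
  rw [Submodule.span_le]
  rintro _ ⟨m, l, hml, rfl⟩
  have length_eq : (u ++ m :: l :: v).length = (u ++ i :: j :: v).length := by simp
  have lex : List.Lex (· < ·) (u ++ m :: l :: v) (u ++ i :: j :: v) := by
    refine List.Lex.append_left _ ?_ u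
    rcases Prod.Lex.toLex_lt_toLex.mp hml with h | ⟨rfl, h⟩
    · exact .rel h
    · exact .cons (.rel h)
  have mem := ih _ (.of_lex length_eq lex)
  rw [length_eq, ← insertBetween_apply] at mem
  exact mem

theorem eq_top_of_prod_map_mem {σ : Type*} {x : σ → A} (hx : Algebra.adjoin k (Set.range x) = ⊤)
    {W : Submodule k A} (h : ∀ w : List σ, (w.map x).prod ∈ W) : W = ⊤ := by
  rw [eq_top_iff, ← Algebra.top_toSubmodule, ← hx, Algebra.adjoin_eq_span, Submodule.span_le,
    ← FreeMonoid.mrange_lift]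
  rintro _ ⟨w, rfl⟩
  rw [SetLike.mem_coe, FreeMonoid.lift_apply]
  exact h w.toList

/-- The word `x_1 ⋯ x_1 x_2 ⋯ x_2 x_3 ⋯ x_3` in which `x_i` occurs `e_i` times. -/
def orderedWord (e : Fin 3 → ℕ) : List (Fin 3) :=
  List.replicate (e 0) 0 ++ List.replicate (e 1) 1 ++ List.replicate (e 2) 2

theorem length_orderedWord (e : Fin 3 → ℕ) : (orderedWord e).length = ∑ i, e i := by
  simp [orderedWord, Fin.sum_univ_three, add_assoc]

theorem prod_map_orderedWord (x : Fin 3 → A) (e : Fin 3 → ℕ) :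
    ((orderedWord e).map x).prod = orderedProduct x e := by
  simp [orderedWord, orderedProduct, mul_assoc]

theorem orderedWord_count {w : List (Fin 3)} (hw : w.IsChain (· ≤ ·)) :
    orderedWord (fun i => w.count i) = w := by
  refine List.Perm.eq_of_pairwise' (r := (· ≤ ·)) ?_ (List.isChain_iff_pairwise.mp hw) ?_
  · simp [orderedWord, List.pairwise_append, List.pairwise_replicate, List.mem_replicate]
  · rw [List.perm_iff_count]
    intro i
    fin_cases i <;> simp [orderedWord, List.count_replicate]

variable {a b p : k} {x : Fin 3 → A}

theorem SymmetricRelations.straighten (H : SymmetricRelations a b x) (i j : Fin 3)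
    (hij : ¬i ≤ j) :
    x i * x j ∈ Submodule.span k {z | ∃ m l, toLex (m, l) < toLex (i, j) ∧ x m * x l = z} := by
  have mem (m l : Fin 3) (h : toLex (m, l) < toLex (i, j)) : x m * x l ∈
      Submodule.span k {z | ∃ m l, toLex (m, l) < toLex (i, j) ∧ x m * x l = z} :=
    Submodule.subset_span ⟨m, l, h, rfl⟩
  obtain ⟨rfl, rfl⟩ | ⟨rfl, rfl⟩ | ⟨rfl, rfl⟩ :
      i = 1 ∧ j = 0 ∨ i = 2 ∧ j = 0 ∨ i = 2 ∧ j = 1 := by omega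
  · exact H.one_mul_zero ▸ mem 0 1 (by decide)
  · exact H.two_mul_zero ▸ add_mem (mem 0 2 (by decide))
      (Submodule.smul_mem _ _ (mem 0 0 (by decide)))
  · exact H.two_mul_one ▸ add_mem (mem 1 2 (by decide))
      (Submodule.smul_mem _ _ (mem 0 1 (by decide)))

theorem ExteriorRelations.straighten (H : ExteriorRelations b p x) (i j : Fin 3)
    (hij : ¬i < j) :
    x i * x j ∈ Submodule.span k {z | ∃ m l, toLex (m, l) < toLex (i, j) ∧ x m * x l = z} := by
  have mem (m l : Fin 3) (h : toLex (m, l) < toLex (i, j)) : x m * x l ∈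
      Submodule.span k {z | ∃ m l, toLex (m, l) < toLex (i, j) ∧ x m * x l = z} :=
    Submodule.subset_span ⟨m, l, h, rfl⟩
  obtain ⟨rfl, rfl⟩ | ⟨rfl, rfl⟩ | ⟨rfl, rfl⟩ | rfl :
      i = 1 ∧ j = 0 ∨ i = 2 ∧ j = 0 ∨ i = 2 ∧ j = 1 ∨ i = j := by omega
  · exact H.one_mul_zero ▸ neg_mem (mem 0 1 (by decide))
  · exact H.two_mul_zero ▸ neg_mem (mem 0 2 (by decide))
  · exact H.two_mul_one ▸ sub_mem (Submodule.smul_mem _ _ (mem 0 1 (by decide)))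
      (mem 1 2 (by decide))
  · match i with
    | 0 => exact H.zero_mul_zero ▸ zero_mem _
    | 1 => exact H.one_mul_one ▸ zero_mem _
    | 2 =>
      exact H.two_mul_two ▸ sub_mem (Submodule.smul_mem _ _ (mem 0 2 (by decide)))
        (Submodule.smul_mem _ _ (mem 0 1 (by decide)))

theorem SymmetricRelations.prod_map_mem_span (H : SymmetricRelations a b x) (w : List (Fin 3)) :
    (w.map x).prod ∈ Submodule.span k (orderedProduct x '' {e | ∑ i, e i = w.length}) := by
  refine Submodule.span_mono ?_ (prod_map_mem_span_isChain H.straighten w)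
  rintro _ ⟨v, hv, length_eq, rfl⟩
  rw [← orderedWord_count hv, length_orderedWord] at length_eq
  rw [← orderedWord_count hv, prod_map_orderedWord]
  exact ⟨_, length_eq, rfl⟩

theorem SymmetricRelations.span_orderedProduct_eq_top (H : SymmetricRelations a b x)
    (hx : Algebra.adjoin k (Set.range x) = ⊤) :
    Submodule.span k (Set.range (orderedProduct x)) = ⊤ :=
  eq_top_of_prod_map_mem hx fun w =>
    Submodule.span_mono (Set.image_subset_range _ _) (H.prod_map_mem_span w)

theorem ExteriorRelations.span_orderedProduct_eq_top (H : ExteriorRelations b p x)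
    (hx : Algebra.adjoin k (Set.range x) = ⊤) :
    Submodule.span k (Set.range fun e : Fin 3 → Fin 2 => orderedProduct x fun i => (e i : ℕ)) =
      ⊤ := by
  refine eq_top_of_prod_map_mem hx fun w =>
    Submodule.span_mono ?_ (prod_map_mem_span_isChain H.straighten w)
  rintro _ ⟨v, hv, -, rfl⟩
  have count_lt_two (i : Fin 3) : v.count i < 2 :=
    Nat.lt_succ_of_le (List.nodup_iff_count_le_one.mp (List.isChain_iff_pairwise.mp hv).nodup i)
  rw [← orderedWord_count (hv.imp fun _ _ => le_of_lt), prod_map_orderedWord]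
  exact ⟨fun i => ⟨v.count i, count_lt_two i⟩, rfl⟩

end Straightening

section Presentation

variable {k : Type*} [Field k]

theorem adjoin_range_mkₐ_ι {σ : Type*} (I : TwoSidedIdeal (FreeAlgebra k σ)) :
    Algebra.adjoin k (Set.range fun i => I.ringCon.mkₐ k (ι k i)) = ⊤ := by
  rw [Algebra.adjoin_range_eq_range_freeAlgebra_lift, lift_mkₐ_ι, AlgHom.range_eq_top]
  exact RingCon.mkₐ_surjective _

theorem eq_of_span_eq_top_of_linearIndependent {A α : Type*} [Ring A] [Algebra k A]
    {I J : TwoSidedIdeal A} (hIJ : I ≤ J) {v : α → A}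
    (hspan : Submodule.span k (Set.range fun i => I.ringCon.mkₐ k (v i)) = ⊤)
    (hind : LinearIndependent k fun i => J.ringCon.mkₐ k (v i)) : I = J := by
  refine le_antisymm hIJ fun y hy => ?_
  obtain ⟨c, hc⟩ := Finsupp.mem_span_range_iff_exists_finsupp.mp
    (hspan ▸ Submodule.mem_top : I.ringCon.mkₐ k y ∈ _)
  have sub_mem : y - c.sum (fun i s => s • v i) ∈ I := by
    rw [← mkₐ_eq_zero_iff (k := k), map_sub, ← hc, map_finsuppSum]
    simp
  have sum_mem : c.sum (fun i s => s • v i) ∈ J := by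
    simpa using J.sub_mem hy (hIJ sub_mem)
  have c_eq_zero : c = 0 := by
    refine linearIndependent_iff.mp hind c ?_
    rw [← (mkₐ_eq_zero_iff (k := k) J).mpr sum_mem, map_finsuppSum]
    simp [Finsupp.linearCombination_apply]
  simpa [c_eq_zero] using sub_mem

end Presentation

section GKDim

open Filter Topology

theorem tendsto_div_log_add (c l : ℝ) :
    Tendsto (fun n : ℕ => ((c / Real.log n + l : ℝ) : EReal)) atTop (𝓝 l) := by
  refine (continuous_coe_real_ereal.tendsto l).comp ?_
  have tendsto_log := Real.tendsto_log_atTop.comp tendsto_natCast_atTop_atTop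
  simpa using (tendsto_log.const_div_atTop c).add_const l

theorem limsup_log_div_log_le {u : ℕ → ℕ} {C : ℝ} {d : ℕ}
    (h : ∀ᶠ n in atTop, (u n : ℝ) ≤ C * (n : ℝ) ^ d) :
    limsup (fun n : ℕ => ((Real.log (u n) / Real.log n : ℝ) : EReal)) atTop ≤ d := by
  refine le_of_le_of_eq (limsup_le_limsup ?_) (tendsto_div_log_add (Real.log (max C 1)) d).limsup_eq
  filter_upwards [h, eventually_ge_atTop 2] with n hu hn
  have one_lt : (1 : ℝ) < n := by exact_mod_cast hn
  have log_pos : 0 < Real.log n := Real.log_pos one_lt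
  rw [EReal.coe_le_coe_iff, div_add' _ _ _ log_pos.ne', div_le_div_iff_of_pos_right log_pos]
  rcases Nat.eq_zero_or_pos (u n) with hu0 | hu0
  · rw [hu0, Nat.cast_zero, Real.log_zero]
    exact add_nonneg (Real.log_nonneg (le_max_right _ _)) (by positivity)
  calc Real.log (u n) ≤ Real.log (max C 1 * (n : ℝ) ^ d) :=
        Real.log_le_log (by exact_mod_cast hu0) (hu.trans (by gcongr; exact le_max_left _ _))
    _ = Real.log (max C 1) + d * Real.log n := by
        rw [Real.log_mul (by positivity) (by positivity), Real.log_pow]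

theorem le_limsup_log_div_log {u : ℕ → ℕ} {c : ℝ} (hc : 0 < c) {d : ℕ}
    (h : ∀ᶠ n : ℕ in atTop, c * (n : ℝ) ^ d ≤ u n) :
    d ≤ limsup (fun n : ℕ => ((Real.log (u n) / Real.log n : ℝ) : EReal)) atTop := by
  refine le_of_eq_of_le (tendsto_div_log_add (Real.log c) d).limsup_eq.symm (limsup_le_limsup ?_)
  filter_upwards [h, eventually_ge_atTop 2] with n hu hn
  have one_lt : (1 : ℝ) < n := by exact_mod_cast hn
  have log_pos : 0 < Real.log n := Real.log_pos one_lt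
  rw [EReal.coe_le_coe_iff, div_add' _ _ _ log_pos.ne', div_le_div_iff_of_pos_right log_pos]
  calc Real.log c + d * Real.log n = Real.log (c * (n : ℝ) ^ d) := by
        rw [Real.log_mul (by positivity) (by positivity), Real.log_pow]
    _ ≤ Real.log (u n) := Real.log_le_log (by positivity) hu

variable {k : Type*} [Field k] {A : Type*} [Ring A] [Algebra k A]

theorem exists_le_of_iSup_eq_top {F : ℕ → Submodule k A} (mono : Monotone F)
    (exhaustive : ⨆ n, F n = ⊤) (W : Submodule k A) [FiniteDimensional k W] : ∃ m, W ≤ F m := by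
  obtain ⟨s, rfl⟩ : W.FG := Module.Finite.iff_fg.mp inferInstance
  choose d hd using fun z : A => (Submodule.mem_iSup_of_directed F mono.directed_le).mp
    (exhaustive ▸ Submodule.mem_top : z ∈ ⨆ n, F n)
  exact ⟨s.sup d, Submodule.span_le.mpr fun z hz => mono (Finset.le_sup hz) (hd z)⟩

theorem gkDim_le_of_filtration {F : ℕ → Submodule k A} [∀ n, FiniteDimensional k (F n)]
    (mono : Monotone F) (one_le : 1 ≤ F 0) (mul_le : ∀ m n, F m * F n ≤ F (m + n))
    (exhaustive : ⨆ n, F n = ⊤) {C d : ℕ} (growth : ∀ n, Module.finrank k (F n) ≤ C * (n + 1) ^ d) :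
    gkDim k A ≤ d := by
  refine iSup_le fun ⟨W, hW, _⟩ => ?_
  obtain ⟨m, hm⟩ := exists_le_of_iSup_eq_top mono exhaustive W
  have pow_le (n : ℕ) : W ^ n ≤ F (m * n) := by
    induction n with
    | zero => simpa using one_le
    | succ n ih => exact pow_succ W n ▸ (mul_le_mul' ih hm).trans (mul_le _ _)
  refine limsup_log_div_log_le (C := C * (m + 1) ^ d) ?_
  filter_upwards [eventually_ge_atTop 1] with n hn
  have finrank_le : Module.finrank k ↥(W ^ n) ≤ C * (m + 1) ^ d * n ^ d :=
    calc Module.finrank k ↥(W ^ n) ≤ C * (m * n + 1) ^ d :=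
          (Submodule.finrank_mono (pow_le n)).trans (growth _)
      _ ≤ C * ((m + 1) * n) ^ d := by gcongr; nlinarith
      _ = C * (m + 1) ^ d * n ^ d := by rw [mul_pow, mul_assoc]
  exact_mod_cast finrank_le

theorem le_gkDim {W : Submodule k A} [FiniteDimensional k W] (one_mem : 1 ∈ W) {c : ℝ}
    (hc : 0 < c) {d : ℕ}
    (growth : ∀ᶠ n : ℕ in atTop, c * (n : ℝ) ^ d ≤ Module.finrank k ↥(W ^ n)) :
    d ≤ gkDim k A :=
  le_iSup_of_le ⟨W, inferInstance, one_mem⟩ (le_limsup_log_div_log hc growth)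

theorem gkDim_eq_zero [Nontrivial A] [FiniteDimensional k A] : gkDim k A = 0 := by
  apply le_antisymm
  · exact_mod_cast gkDim_le_of_filtration (F := fun _ => (⊤ : Submodule k A)) (d := 0)
      (C := Module.finrank k A) monotone_const le_top (fun _ _ => le_top) ciSup_const (by simp)
  · have : FiniteDimensional k (1 : Submodule k A) :=
      Submodule.one_eq_span (R := k) (A := A) ▸ inferInstance
    refine mod_cast le_gkDim (W := (1 : Submodule k A)) (d := 0) (Submodule.one_le.mp le_rfl)
      one_pos (Eventually.of_forall fun n => ?_)
    rw [one_pow, Submodule.one_eq_span, finrank_span_singleton one_ne_zero]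
    simp

/-- The span of the ordered monomials of degree at most `n`. -/
def monomialFiltration (k : Type*) [Field k] {A : Type*} [Ring A] [Algebra k A] (x : Fin 3 → A)
    (n : ℕ) : Submodule k A :=
  Submodule.span k (orderedProduct x '' {e | ∑ i, e i ≤ n})

variable {x : Fin 3 → A} {a b : k}

theorem orderedProduct_mem_monomialFiltration {e : Fin 3 → ℕ} {n : ℕ} (he : ∑ i, e i ≤ n) :
    orderedProduct x e ∈ monomialFiltration k x n :=
  Submodule.subset_span ⟨e, he, rfl⟩

theorem monomialFiltration_mono : Monotone (monomialFiltration k x) :=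
  fun _ _ hmn => Submodule.span_mono (Set.image_mono fun _ he => le_trans he hmn)

theorem one_le_monomialFiltration (n : ℕ) : 1 ≤ monomialFiltration k x n :=
  Submodule.one_le.mpr <| by
    simpa [orderedProduct] using orderedProduct_mem_monomialFiltration (k := k) (x := x) (e := 0)
      (n := n) (by simp)

theorem iSup_monomialFiltration (hspan : Submodule.span k (Set.range (orderedProduct x)) = ⊤) :
    ⨆ n, monomialFiltration k x n = ⊤ := by
  rw [eq_top_iff, ← hspan, Submodule.span_le]
  rintro _ ⟨e, rfl⟩
  exact Submodule.mem_iSup_of_mem _ (orderedProduct_mem_monomialFiltration le_rfl)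

theorem SymmetricRelations.monomialFiltration_mul_le (H : SymmetricRelations a b x) (m n : ℕ) :
    monomialFiltration k x m * monomialFiltration k x n ≤ monomialFiltration k x (m + n) := by
  refine (Submodule.span_mul_span k _ _).trans_le (Submodule.span_le.mpr ?_)
  rintro _ ⟨_, ⟨e, he, rfl⟩, _, ⟨e', he', rfl⟩, rfl⟩
  have mem := H.prod_map_mem_span (orderedWord e ++ orderedWord e')
  rw [List.map_append, List.prod_append, prod_map_orderedWord, prod_map_orderedWord,
    List.length_append, length_orderedWord, length_orderedWord] at mem
  have degree_le : ∑ i, e i + ∑ i, e' i ≤ m + n := add_le_add he he'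
  exact Submodule.span_mono (Set.image_mono fun _ degree_eq => degree_eq.trans_le degree_le) mem

theorem monomialFiltration_le_span_range (n : ℕ) :
    monomialFiltration k x n ≤ Submodule.span k
      (Set.range fun e : Fin 3 → Fin (n + 1) => orderedProduct x fun i => (e i : ℕ)) := by
  refine Submodule.span_mono ?_
  rintro _ ⟨e, he, rfl⟩
  exact ⟨fun i => ⟨e i, Nat.lt_succ_of_le
    ((Finset.single_le_sum (fun _ _ => Nat.zero_le _) (Finset.mem_univ i)).trans he)⟩, rfl⟩

instance finiteDimensional_monomialFiltration (n : ℕ) :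
    FiniteDimensional k (monomialFiltration k x n) :=
  have := FiniteDimensional.span_of_finite k (Set.finite_range
    fun e : Fin 3 → Fin (n + 1) => orderedProduct x fun i => (e i : ℕ))
  Submodule.finiteDimensional_of_le (monomialFiltration_le_span_range n)

theorem finrank_monomialFiltration_le (n : ℕ) :
    Module.finrank k (monomialFiltration k x n) ≤ (n + 1) ^ 3 := by
  have := FiniteDimensional.span_of_finite k (Set.finite_range
    fun e : Fin 3 → Fin (n + 1) => orderedProduct x fun i => (e i : ℕ))
  calc Module.finrank k (monomialFiltration k x n)
    _ ≤ _ := Submodule.finrank_mono (monomialFiltration_le_span_range n)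
    _ ≤ Fintype.card (Fin 3 → Fin (n + 1)) := finrank_range_le_card _
    _ = (n + 1) ^ 3 := by simp

theorem monomialFiltration_le_pow (n : ℕ) :
    monomialFiltration k x n ≤ monomialFiltration k x 1 ^ n := by
  have letter_mem (i : Fin 3) : x i ∈ monomialFiltration k x 1 := by
    have := orderedProduct_mem_monomialFiltration (k := k) (x := x) (e := Pi.single i 1) (n := 1)
      (by simp)
    fin_cases i <;> simpa [orderedProduct] using this
  refine Submodule.span_le.mpr ?_
  rintro _ ⟨e, he, rfl⟩
  refine pow_le_pow_right' (one_le_monomialFiltration 1) he ?_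
  rw [Fin.sum_univ_three, pow_add, pow_add]
  exact Submodule.mul_mem_mul (Submodule.mul_mem_mul (Submodule.pow_mem_pow _ (letter_mem 0) _)
    (Submodule.pow_mem_pow _ (letter_mem 1) _)) (Submodule.pow_mem_pow _ (letter_mem 2) _)

theorem le_finrank_monomialFiltration (hind : LinearIndependent k (orderedProduct x)) (n : ℕ) :
    (n / 3 + 1) ^ 3 ≤ Module.finrank k (monomialFiltration k x n) := by
  have box_linearIndependent : LinearIndependent k
      (fun e : Fin 3 → Fin (n / 3 + 1) => orderedProduct x fun i => (e i : ℕ)) :=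
    hind.comp (fun (e : Fin 3 → Fin (n / 3 + 1)) i => (e i : ℕ)) fun e e' h =>
      funext fun i => Fin.ext (congrFun h i)
  have box_le : Submodule.span k (Set.range fun e : Fin 3 → Fin (n / 3 + 1) =>
      orderedProduct x fun i => (e i : ℕ)) ≤ monomialFiltration k x n := by
    refine Submodule.span_le.mpr ?_
    rintro _ ⟨e, rfl⟩
    refine orderedProduct_mem_monomialFiltration ?_
    rw [Fin.sum_univ_three]
    omega
  simpa [finrank_span_eq_card box_linearIndependent] using Submodule.finrank_mono box_le

theorem SymmetricRelations.gkDim_eq_three (H : SymmetricRelations a b x)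
    (hspan : Submodule.span k (Set.range (orderedProduct x)) = ⊤)
    (hind : LinearIndependent k (orderedProduct x)) : gkDim k A = 3 := by
  apply le_antisymm
  · exact gkDim_le_of_filtration monomialFiltration_mono (one_le_monomialFiltration 0)
      H.monomialFiltration_mul_le (iSup_monomialFiltration hspan) (C := 1) (d := 3)
      fun n => (one_mul ((n + 1) ^ 3)).symm ▸ finrank_monomialFiltration_le n
  · refine le_gkDim (W := monomialFiltration k x 1) (c := (1 / 3) ^ 3) (d := 3)
      (Submodule.one_le.mp (one_le_monomialFiltration 1)) (by positivity)
      (Eventually.of_forall fun n => ?_)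
    have : FiniteDimensional k ↥(monomialFiltration k x 1 ^ n) :=
      Module.Finite.iff_fg.mpr ((Module.Finite.iff_fg.mp inferInstance).pow n)
    calc (1 / 3) ^ 3 * (n : ℝ) ^ 3 = (n / 3) ^ 3 := by rw [← mul_pow]; ring
      _ ≤ ((n / 3 + 1 : ℕ) : ℝ) ^ 3 := by
        gcongr
        rw [div_le_iff₀ three_pos]
        exact_mod_cast (by omega : n ≤ (n / 3 + 1) * 3)
      _ ≤ Module.finrank k ↥(monomialFiltration k x 1 ^ n) := by
        exact_mod_cast (le_finrank_monomialFiltration hind n).trans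
          (Submodule.finrank_mono (monomialFiltration_le_pow n))

end GKDim

section QuadraticRelations

variable {k : Type*} [Field k]

theorem exists_coeff_of_mem_tensorPower_two {σ : Type*} [Fintype σ] {x : FreeAlgebra k σ}
    (hx : x ∈ tensorPower k σ 2) :
    ∃ s : σ → σ → k, x = ∑ i, ∑ j, s i j • (ι k i * ι k j) := by
  have le_span : tensorPower k σ 2 ≤
      Submodule.span k (Set.range fun ij : σ × σ => ι k ij.1 * ι k ij.2) := by
    rw [tensorPower, pow_two, Submodule.span_mul_span, Submodule.span_le]
    rintro _ ⟨_, ⟨i, rfl⟩, _, ⟨j, rfl⟩, rfl⟩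
    exact Submodule.subset_span ⟨(i, j), rfl⟩
  obtain ⟨s, rfl⟩ := (Submodule.mem_span_range_iff_exists_fun k).mp (le_span hx)
  exact ⟨fun i j => s (i, j), Fintype.sum_prod_type _⟩

theorem algebraMapInv_skewDeriv_skewDeriv {σ : Type*} [Fintype σ] [DecidableEq σ]
    (r : σ → σ → σ → σ → k) (i j m l : σ) :
    algebraMapInv (skewDeriv r m (skewDeriv r l (ι k i * ι k j))) =
      (if j = l then if i = m then 1 else 0 else 0) + r i j m l := by
  rw [skewDeriv_ι_mul, letterBraiding_ι, skewDeriv_ι, mul_ite, mul_one, mul_zero]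
  simp only [map_add, map_sum, map_smul, skewDeriv_ι, apply_ite (skewDeriv r m), map_zero]
  congr 1
  · split_ifs <;> simp
  · simp [apply_ite, algebraMapInv]

/- The equations say that `1 + c` kills `∑ i j, s i j x_i ⊗ x_j`. -/
theorem coeff_add_sum_eq_zero_of_mem_nicholsIdeal {σ : Type*} [Fintype σ] [DecidableEq σ]
    {r : σ → σ → σ → σ → k} {s : σ → σ → k}
    (hs : ∑ i, ∑ j, s i j • (ι k i * ι k j) ∈ nicholsIdeal r) (m l : σ) :
    s m l + ∑ i, ∑ j, s i j * r i j m l = 0 := by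
  have hJ := isHopfIdeal_nicholsIdeal r
  simpa [algebraMapInv_skewDeriv_skewDeriv, mul_add, Finset.sum_add_distrib] using
    hJ.algebraMapInv_eq_zero (hJ.skewDeriv_mem m (hJ.skewDeriv_mem l hs))

/- Modulo `x_1 ⊗ V + V ⊗ x_1` and then modulo `x_1 ⊗ x_1`, `c` is `t` times the flip, so
the coefficients of a vector in the kernel of `1 + c` vanish in that order. -/
theorem eq_zero_of_add_sum_braidingR11_eq_zero {t a b p : k} (ht : t ^ 2 ≠ 1)
    {s : Fin 3 → Fin 3 → k}
    (hs : ∀ m l, s m l + ∑ i, ∑ j, s i j * braidingR11 t a b p i j m l = 0) : s = 0 := by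
  have cancel {c : k} (h : (1 - t ^ 2) * c = 0) : c = 0 :=
    (mul_eq_zero.mp h).resolve_left (sub_ne_zero.mpr ht.symm)
  simp only [Fin.forall_fin_succ, Fin.sum_univ_three, braidingR11, Matrix.of_apply,
    Matrix.cons_val, IsEmpty.forall_iff, and_true, Fin.succ_zero_eq_one, Fin.succ_one_eq_two,
    mul_zero, add_zero, zero_add] at hs
  obtain ⟨⟨h00, h01, h02⟩, ⟨h10, h11, h12⟩, h20, h21, h22⟩ := hs
  have s22 : s 2 2 = 0 := cancel (by linear_combination (1 - t) * h22)
  have s11 : s 1 1 = 0 := cancel (by linear_combination (1 - t) * h11)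
  have s12 : s 1 2 = 0 := cancel (by linear_combination h12 - t * h21)
  have s21 : s 2 1 = 0 := cancel (by linear_combination h21 - t * h12)
  simp only [s22, s12, s21, zero_mul, add_zero] at h00 h01 h10 h02 h20
  have s02 : s 0 2 = 0 := cancel (by linear_combination h02 - t * h20)
  have s20 : s 2 0 = 0 := cancel (by linear_combination h20 - t * h02)
  have s01 : s 0 1 = 0 := cancel (by linear_combination h01 - t * h10)
  have s10 : s 1 0 = 0 := cancel (by linear_combination h10 - t * h01)
  simp only [s02, s20, zero_mul, add_zero] at h00
  have s00 : s 0 0 = 0 := cancel (by linear_combination (1 - t) * h00)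
  ext i j
  fin_cases i <;> fin_cases j <;> assumption

theorem eq_zero_of_mem_tensorPower_two_of_mem_nicholsIdeal {t a b p : k} (ht : t ^ 2 ≠ 1)
    {x : FreeAlgebra k (Fin 3)} (hx : x ∈ tensorPower k (Fin 3) 2)
    (hJ : x ∈ nicholsIdeal (braidingR11 t a b p)) : x = 0 := by
  obtain ⟨s, rfl⟩ := exists_coeff_of_mem_tensorPower_two hx
  obtain rfl := eq_zero_of_add_sum_braidingR11_eq_zero ht
    (coeff_add_sum_eq_zero_of_mem_nicholsIdeal hJ)
  simp

end QuadraticRelations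

section NicholsAlgebras

variable {k : Type*} [Field k]

section SymmetricCase

theorem symmetricRelations_gen (a b p : k) :
    SymmetricRelations a b (NicholsAlgebra.gen (braidingR11 1 a b p)) :=
  lift_relationsOne.mp (lift_mkₐ_eq_zero (isHopfIdeal_relationsOne a b p).le_nicholsIdeal)

theorem span_orderedMonomial_one_eq_top (a b p : k) :
    Submodule.span k (Set.range (orderedMonomial (braidingR11 1 a b p))) = ⊤ :=
  (symmetricRelations_gen a b p).span_orderedProduct_eq_top (adjoin_range_mkₐ_ι _)

variable [CharZero k]

theorem linearIndependent_orderedMonomial_one (a b p : k) :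
    LinearIndependent k (orderedMonomial (braidingR11 1 a b p)) :=
  linearIndependent_orderedMonomial Function.injective_id fun e i => by
    rw [qFactorial_one_left]
    exact Nat.cast_ne_zero.mpr (Nat.factorial_ne_zero _)

theorem nicholsIdeal_braidingR11_one (a b p : k) :
    nicholsIdeal (braidingR11 1 a b p) = TwoSidedIdeal.span (relationsOne a b) := by
  refine (eq_of_span_eq_top_of_linearIndependent (k := k) (v := orderedProduct X)
    (isHopfIdeal_relationsOne a b p).le_nicholsIdeal ?_ ?_).symm
  · simp_rw [map_orderedProduct]
    exact (lift_relationsOne.mp (lift_mkₐ_eq_zero le_rfl)).span_orderedProduct_eq_top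
      (adjoin_range_mkₐ_ι _)
  · simp_rw [mkₐ_orderedProduct]
    exact linearIndependent_orderedMonomial_one a b p

theorem gkDim_nicholsAlgebra_one (a b p : k) :
    gkDim k (NicholsAlgebra (braidingR11 1 a b p)) = 3 :=
  (symmetricRelations_gen a b p).gkDim_eq_three (span_orderedMonomial_one_eq_top a b p)
    (linearIndependent_orderedMonomial_one a b p)

end SymmetricCase

section ExteriorCase

theorem exteriorRelations_gen (a b p : k) :
    ExteriorRelations b p (NicholsAlgebra.gen (braidingR11 (-1) a b p)) :=
  lift_relationsMinusOne.mp
    (lift_mkₐ_eq_zero (isHopfIdeal_relationsMinusOne a b p).le_nicholsIdeal)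

theorem span_orderedMonomial_neg_one_eq_top (a b p : k) :
    Submodule.span k (Set.range fun e : Fin 3 → Fin 2 =>
      orderedMonomial (braidingR11 (-1) a b p) fun i => (e i : ℕ)) = ⊤ :=
  (exteriorRelations_gen a b p).span_orderedProduct_eq_top (adjoin_range_mkₐ_ι _)

theorem linearIndependent_orderedMonomial_neg_one (a b p : k) :
    LinearIndependent k fun e : Fin 3 → Fin 2 =>
      orderedMonomial (braidingR11 (-1) a b p) fun i => (e i : ℕ) :=
  linearIndependent_orderedMonomial Fin.val_injective.comp_left fun e i => by
    rw [qFactorial_of_le_one _ (Nat.le_of_lt_succ (e i).isLt)]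
    exact one_ne_zero

theorem nicholsIdeal_braidingR11_neg_one (a b p : k) :
    nicholsIdeal (braidingR11 (-1) a b p) = TwoSidedIdeal.span (relationsMinusOne b p) := by
  refine (eq_of_span_eq_top_of_linearIndependent (k := k)
    (v := fun e : Fin 3 → Fin 2 => orderedProduct X fun i => (e i : ℕ))
    (isHopfIdeal_relationsMinusOne a b p).le_nicholsIdeal ?_ ?_).symm
  · simp_rw [map_orderedProduct]
    exact (lift_relationsMinusOne.mp (lift_mkₐ_eq_zero le_rfl)).span_orderedProduct_eq_top
      (adjoin_range_mkₐ_ι _)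
  · simp_rw [mkₐ_orderedProduct]
    exact linearIndependent_orderedMonomial_neg_one a b p

theorem finrank_nicholsAlgebra_neg_one (a b p : k) :
    Module.finrank k (NicholsAlgebra (braidingR11 (-1) a b p)) = 8 := by
  rw [Module.finrank_eq_card_basis (Module.Basis.mk
    (linearIndependent_orderedMonomial_neg_one a b p)
    (span_orderedMonomial_neg_one_eq_top a b p).ge)]
  simp

theorem gkDim_nicholsAlgebra_neg_one (a b p : k) :
    gkDim k (NicholsAlgebra (braidingR11 (-1) a b p)) = 0 := by
  have finrank_pos : 0 < Module.finrank k (NicholsAlgebra (braidingR11 (-1) a b p)) := by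
    simp [finrank_nicholsAlgebra_neg_one]
  have := FiniteDimensional.of_finrank_pos finrank_pos
  have := Module.nontrivial_of_finrank_pos finrank_pos
  exact gkDim_eq_zero

end ExteriorCase

end NicholsAlgebras

end BraidedNichols

open BraidedNichols in
theorem proposition3p1_general {k : Type*} [Field k] (t a b p : k) :
    (t ^ 2 ≠ 1 →
      ∀ x ∈ tensorPower k (Fin 3) 2, x ∈ nicholsIdeal (braidingR11 t a b p) → x = 0) ∧
    (t = -1 →
      nicholsIdeal (braidingR11 t a b p) = TwoSidedIdeal.span (relationsMinusOne b p) ∧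
      LinearIndependent k (fun e : Fin 3 → Fin 2 =>
        orderedMonomial (braidingR11 t a b p) (fun i => (e i : ℕ))) ∧
      Submodule.span k (Set.range fun e : Fin 3 → Fin 2 =>
        orderedMonomial (braidingR11 t a b p) (fun i => (e i : ℕ))) = ⊤ ∧
      Module.finrank k (NicholsAlgebra (braidingR11 t a b p)) = 8 ∧
      gkDim k (NicholsAlgebra (braidingR11 t a b p)) = 0) ∧
    (t = 1 → CharZero k →
      nicholsIdeal (braidingR11 t a b p) = TwoSidedIdeal.span (relationsOne a b) ∧
      LinearIndependent k (fun e : Fin 3 → ℕ => orderedMonomial (braidingR11 t a b p) e) ∧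
      Submodule.span k (Set.range fun e : Fin 3 → ℕ =>
        orderedMonomial (braidingR11 t a b p) e) = ⊤ ∧
      gkDim k (NicholsAlgebra (braidingR11 t a b p)) = 3) := by
  refine ⟨fun ht x hx hJ => eq_zero_of_mem_tensorPower_two_of_mem_nicholsIdeal ht hx hJ, ?_, ?_⟩
  · rintro rfl
    exact ⟨nicholsIdeal_braidingR11_neg_one a b p, linearIndependent_orderedMonomial_neg_one a b p,
      span_orderedMonomial_neg_one_eq_top a b p, finrank_nicholsAlgebra_neg_one a b p,
      gkDim_nicholsAlgebra_neg_one a b p⟩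
  · rintro rfl _
    exact ⟨nicholsIdeal_braidingR11_one a b p, linearIndependent_orderedMonomial_one a b p,
      span_orderedMonomial_one_eq_top a b p, gkDim_nicholsAlgebra_one a b p⟩

theorem proposition3p1 {k : Type*} [Field k] [CharZero k] (t a b p : k) (ht : t ≠ 0) :
    -- if `t ^ 2 ≠ 1`, there are no quadratic relations
    (t ^ 2 ≠ 1 →
      ∀ x ∈ BraidedNichols.tensorPower k (Fin 3) 2,
        x ∈ BraidedNichols.nicholsIdeal (BraidedNichols.braidingR11 t a b p) → x = 0) ∧
    -- `t = -1`: presentation, basis, dimension and GK-dimension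
    (t = -1 →
      BraidedNichols.nicholsIdeal (BraidedNichols.braidingR11 t a b p) =
        TwoSidedIdeal.span (BraidedNichols.relationsMinusOne b p) ∧
      LinearIndependent k (fun e : Fin 3 → Fin 2 =>
        BraidedNichols.orderedMonomial (BraidedNichols.braidingR11 t a b p)
          (fun i => (e i : ℕ))) ∧
      Submodule.span k (Set.range fun e : Fin 3 → Fin 2 =>
        BraidedNichols.orderedMonomial (BraidedNichols.braidingR11 t a b p)
          (fun i => (e i : ℕ))) = ⊤ ∧
      Module.finrank k
        (BraidedNichols.NicholsAlgebra (BraidedNichols.braidingR11 t a b p)) = 8 ∧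
      BraidedNichols.gkDim k
        (BraidedNichols.NicholsAlgebra (BraidedNichols.braidingR11 t a b p)) = 0) ∧
    -- `t = 1`: presentation, basis and GK-dimension
    (t = 1 →
      BraidedNichols.nicholsIdeal (BraidedNichols.braidingR11 t a b p) =
        TwoSidedIdeal.span (BraidedNichols.relationsOne a b) ∧
      LinearIndependent k (fun e : Fin 3 → ℕ =>
        BraidedNichols.orderedMonomial (BraidedNichols.braidingR11 t a b p) e) ∧
      Submodule.span k (Set.range fun e : Fin 3 → ℕ =>
        BraidedNichols.orderedMonomial (BraidedNichols.braidingR11 t a b p) e) = ⊤ ∧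
      BraidedNichols.gkDim k
        (BraidedNichols.NicholsAlgebra (BraidedNichols.braidingR11 t a b p)) = 3) :=
  have ⟨quadratic, exterior, symmetric⟩ := proposition3p1_general t a b p
  ⟨quadratic, exterior, fun ht_one => symmetric ht_one inferInstance⟩
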